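/- **Setting.** For convex $f_1,\dots,f_n:\mathbb{R}^d\to\mathbb{R}$ put $p(x)=\frac1n\sum_i f_i(x)+\frac r2\|x\|^2$ and $\mathbf T_i=\partial f_i$ on $\mathcal H=\mathbb R^d$; for $f_i:\mathbb{R}^{d_\xi}\times\mathbb{R}^{d_\zeta}\to\mathbb{R}$ convex in $\xi$ and concave in $\zeta$ put $p(\xi,\zeta)=\frac1n\sum_i f_i(\xi,\zeta)+\frac r2\|\xi\|^2-\frac r2\|\zeta\|^2$ and $\mathbf T_i=[\partial_\xi f_i,-\partial_\zeta f_i]$ on $\mathcal H=\mathbb R^{d_\xi+d_\zeta}$. In both cases $r=0$, every $g\in\mathbf T_i(x)$ has $\|g\|\le M$, and there is a solution $x^*$ (a minimizer, respectively a saddle point $(\xi^*,\zeta^*)$, of $p$) with $\|x^*\|\le R$. The gap is $G(x_o)=p(x_o)-p(x^*)$, respectively $G(x_o)=p(\xi_o,\zeta^*)-p(\xi^*,\zeta_o)$. A *time-varying network with condition number $\chi\ge1$* consists of edge sets $\mathcal E(\tau)$ on $\{1,\dots,n\}$ and matrices $\mathbf W(\tau)\in\mathbb R^{n\times n}$, $\tau\ge0$,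 with $\mathbf W(\tau)_{ij}=0$ if $i\ne j$ and $(j,i)\notin\mathcal E(\tau)$, $\mathbf W(\tau)\mathbf 1=0=\mathbf W(\tau)^\top\mathbf 1$, and $\|\mathbf W(\tau)x-x\|^2\le(1-\frac1\chi)\|x\|^2$ whenever $\sum_i x_i=0$. A *stochastic oracle of level $\sigma$* answers the query of a point $x\in\mathcal H$ at node $i$ by a random vector $\tilde{\mathbf g}_i(x)$ with $\mathbb E\,\tilde{\mathbf g}_i(x)\in\mathbf T_i(x)$ and $\mathbb E\|\tilde{\mathbf g}_i(x)-\mathbb E\,\tilde{\mathbf g}_i(x)\|^2\le\sigma^2$; the randomness is independent and identically distributed over successive calls (at one call, the answers at different nodes may be dependent). **Algorithm.** It has parameters $K,T\in\{1,2,\dots\}$, $r_{yz}>0$ and nonnegative sequences $\alpha_k,\beta_k,\gamma_k,\sigma_k,\lambda_k,\tau_x^k,\eta_x^k,\eta_y^k,\eta_z^k,\theta_z^k$. The input is $x^0,y^0,z^0,m^0\in\mathcal H^n$ with $\sum_i z^0_i=0$; set $x^{-1}=\tilde x^0=\bar x^0=x^0$, $\bar y^0=y^0$, $\bar z^0=z^0$.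 Outer iteration $k=0,\dots,K-1$ takes place at time $\tau_k$, where $0\le\tau_0<\tau_1<\cdots$ is a given schedule, and computes $$\underline y^k=\alpha_ky^k+(1-\alpha_k)\bar y^k,\quad \underline z^k=\alpha_kz^k+(1-\alpha_k)\bar z^k,\quad g_y^k=g_z^k=r_{yz}(\underline y^k+\underline z^k),$$ $$\tilde g_z^k=(\mathbf W(\tau_k)\otimes\mathbf I)g_z^k,\quad \hat g_z^k=(\mathbf W(\tau_k)\otimes\mathbf I)(g_z^k+m^k)\quad\text{(one communication)},$$ $$\hat x^{k+1}=x^k+\gamma_k(\tilde x^k-x^{k-1}),\quad y^{k+1}=y^k-\eta_y^k(g_y^k+\hat x^{k+1}),\quad z^{k+1}=z^k-\eta_z^k\hat g_z^k,$$ $$\bar y^{k+1}=\underline y^k+\alpha_k(y^{k+1}-y^k),\quad \bar z^{k+1}=\underline z^k-\theta_z^k\tilde g_z^k,\quad m^{k+1}=\tfrac{\eta_z^k}{\eta_z^{k+1}}(m^k+g_z^k-\hat g_z^k);$$ then, starting from $x^{k,0}=x^k$, for $t=0,\dots,T-1$ it makes one oracle call, $g_x^{k,t}=(\tilde{\mathbf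 g}_1(x_1^{k,t}),\dots,\tilde{\mathbf g}_n(x_n^{k,t}))$, and solves $$x^{k,t+1}=x^{k,t}-\eta_x^k\big(g_x^{k,t}+\beta_kx^{k,t+1}-y^{k+1}+\tau_x^k(x^{k,t+1}-x^k)\big);$$ finally $\tilde x^{k+1}=\frac1T\sum_{t=1}^Tx^{k,t}$, $x^{k+1}=\sigma_kx^{k,T}+(1-\sigma_k)\tilde x^{k+1}$, $\bar x^{k+1}=\alpha_k\tilde x^{k+1}+(1-\alpha_k)\bar x^k$. The output is $x_o^K=\frac1n\sum_{i=1}^n x^K_{a,i}$ with $x_a^K=(\sum_{k=1}^K\lambda_k)^{-1}\sum_{k=1}^K\lambda_k\bar x^k$. (Quotients by $0$ are read as $0$.) It uses $K$ communications and $KT$ oracle calls. **Proposition (lower bound, monotone case $r=0$).** There is a universal constant $c>0$ such that for all $M,R>0$, $\chi\ge1$, $\sigma\ge0$ and $0<\varepsilon\le cMR$ the following holds, both for convex minimization and for convex-concave saddle point problems. There are a number of nodes $n$ and dimensions such that for every input of the algorithm (in particular for zero input) and every schedule there exist a problem as above with constants $M$ and $R$, a time-varying network with condition number $\chi$, and a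 stochastic oracle of level $\sigma$ for which, for all $K$, $T$ and all choices of the parameters, $$\mathbb E[G(x_o^K)]\le\varepsilon\quad\Longrightarrow\quad K\ge c\,\frac{\chi MR}{\varepsilon}\quad\text{and}\quad KT\ge c\,\frac{(M+\sigma)^2R^2}{\varepsilon^2}.$$ -/

import Mathlib

open MeasureTheory
open scoped NNReal

noncomputable section

namespace DecOpt

/-! ### Objectives, solutions, gap functions and operators -/

/-- `∂ f x`: the convex subdifferential of `f` at `x`. -/
def subdiff {E : Type*} [NormedAddCommGroup E] [InnerProductSpace ℝ E] (f : E → ℝ) (x : E) :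
    Set E :=
  {g | ∀ y, f x + inner ℝ g (y - x) ≤ f y}

/-- `ℝ^d` with the Euclidean norm: the solution space of the minimization problem. -/
abbrev Vec (d : ℕ) : Type := EuclideanSpace ℝ (Fin d)

/-- `ℝ^(d₁ + d₂)`, as the Euclidean product of `ℝ^d₁` and `ℝ^d₂`: the solution space of the
saddle point problem. The components of `x` are `x.fst` and `x.snd`. -/
abbrev Vec₂ (d₁ d₂ : ℕ) : Type := WithLp 2 (Vec d₁ × Vec d₂)

/-- `p(x) = (1/n) ∑ i, f i x + (r/2) ‖x‖²`. -/
def cvxObjective {n d : ℕ} (r : ℝ) (f : Fin n → Vec d → ℝ) (x : Vec d) : ℝ :=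
  (1 / (n : ℝ)) * ∑ i, f i x + r / 2 * ‖x‖ ^ 2

/-- `p(ξ, ζ) = (1/n) ∑ i, f i ξ ζ + (r/2) ‖ξ‖² - (r/2) ‖ζ‖²`. -/
def sppObjective {n d₁ d₂ : ℕ} (r : ℝ) (f : Fin n → Vec d₁ → Vec d₂ → ℝ)
    (ξ : Vec d₁) (ζ : Vec d₂) : ℝ :=
  (1 / (n : ℝ)) * ∑ i, f i ξ ζ + r / 2 * ‖ξ‖ ^ 2 - r / 2 * ‖ζ‖ ^ 2

/-- `xs` solves `min_x p(x)`. -/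
def IsCvxSolution {n d : ℕ} (r : ℝ) (f : Fin n → Vec d → ℝ) (xs : Vec d) : Prop :=
  ∀ x, cvxObjective r f xs ≤ cvxObjective r f x

/-- `xs` solves `min_ξ max_ζ p(ξ, ζ)`, that is, it is a saddle point of `p`. -/
def IsSppSolution {n d₁ d₂ : ℕ} (r : ℝ) (f : Fin n → Vec d₁ → Vec d₂ → ℝ)
    (xs : Vec₂ d₁ d₂) : Prop :=
  ∀ ξ ζ, sppObjective r f xs.fst ζ ≤ sppObjective r f xs.fst xs.snd ∧
    sppObjective r f xs.fst xs.snd ≤ sppObjective r f ξ xs.snd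

/-- The gap `p(x_o) - p(x*)`. -/
def cvxGap {n d : ℕ} (r : ℝ) (f : Fin n → Vec d → ℝ) (xs xo : Vec d) : ℝ :=
  cvxObjective r f xo - cvxObjective r f xs

/-- The gap `p(ξ_o, ζ*) - p(ξ*, ζ_o)`. -/
def sppGap {n d₁ d₂ : ℕ} (r : ℝ) (f : Fin n → Vec d₁ → Vec d₂ → ℝ)
    (xs xo : Vec₂ d₁ d₂) : ℝ :=
  sppObjective r f xo.fst xs.snd - sppObjective r f xs.fst xo.snd

/-- `T_i(x) = ∂ f_i(x)`. -/
def cvxOperator {n d : ℕ} (f : Fin n → Vec d → ℝ) (i : Fin n) (x : Vec d) : Set (Vec d) :=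
  subdiff (f i) x

/-- `T_i(x) = [∂_ξ f_i(ξ, ζ), -∂_ζ f_i(ξ, ζ)]` at `x = (ξ, ζ)`. Since `f_i` is concave in `ζ`,
`-∂_ζ f_i` is the convex subdifferential of `-f_i` in `ζ`. -/
def sppOperator {n d₁ d₂ : ℕ} (f : Fin n → Vec d₁ → Vec d₂ → ℝ) (i : Fin n)
    (x : Vec₂ d₁ d₂) : Set (Vec₂ d₁ d₂) :=
  {g | g.fst ∈ subdiff (fun ξ => f i ξ x.snd) x.fst ∧
    g.snd ∈ subdiff (fun ζ => -f i x.fst ζ) x.snd}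

/-- All values of the operators are bounded by `M`. -/
def OperatorBound {n : ℕ} {H : Type*} [Norm H] (M : ℝ) (T : Fin n → H → Set H) : Prop :=
  ∀ i x, ∀ g ∈ T i x, ‖g‖ ≤ M

/-- The standing assumptions on a minimization problem: each `f i` is convex with subgradients
bounded by `M`, and `xs` is a solution of norm at most `R`. -/
structure CvxAssumptions {n d : ℕ} (r M R : ℝ) (f : Fin n → Vec d → ℝ) (xs : Vec d) : Prop where
  convex : ∀ i, ConvexOn ℝ Set.univ (f i)
  bound : OperatorBound M (cvxOperator f)
  solution : IsCvxSolution r f xs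
  radius : ‖xs‖ ≤ R

/-- The standing assumptions on a saddle point problem: each `f i` is convex-concave with
operator bounded by `M`, and `xs` is a solution of norm at most `R`. -/
structure SppAssumptions {n d₁ d₂ : ℕ} (r M R : ℝ) (f : Fin n → Vec d₁ → Vec d₂ → ℝ)
    (xs : Vec₂ d₁ d₂) : Prop where
  convex : ∀ i ζ, ConvexOn ℝ Set.univ (fun ξ => f i ξ ζ)
  concave : ∀ i ξ, ConcaveOn ℝ Set.univ (fun ζ => f i ξ ζ)
  bound : OperatorBound M (sppOperator f)
  solution : IsSppSolution r f xs
  radius : ‖xs‖ ≤ R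

/-! ### Time-varying network and stochastic oracle -/

/-- The assumptions on a time-varying network on the nodes `Fin n` with edge sets `edges t` and
gossip matrices `W t`, with condition number `χ`. -/
structure NetworkAssumptions {n : ℕ} (χ : ℝ) (edges : ℝ≥0 → Set (Fin n × Fin n))
    (W : ℝ≥0 → Matrix (Fin n) (Fin n) ℝ) : Prop where
  support : ∀ t i j, i ≠ j → (j, i) ∉ edges t → W t i j = 0
  row_sum : ∀ t i, ∑ j, W t i j = 0
  col_sum : ∀ t j, ∑ i, W t i j = 0
  contraction : ∀ t (x : Fin n → ℝ), ∑ i, x i = 0 →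
    ∑ i, ((W t).mulVec x i - x i) ^ 2 ≤ (1 - 1 / χ) * ∑ i, x i ^ 2

/-- `g i s x` is the answer of the oracle of node `i` to the query `x` under the random seed `s`,
and `law` is the distribution of the seed of one call: the answer is unbiased for the operator
`T i` and its variance is at most `σ²`. -/
structure OracleAssumptions {n : ℕ} {H S : Type*} [NormedAddCommGroup H] [InnerProductSpace ℝ H]
    [MeasurableSpace H] [MeasurableSpace S] (T : Fin n → H → Set H) (σ : ℝ) (law : Measure S)
    (g : Fin n → S → H → H) : Prop where
  measurable : ∀ i, Measurable (Function.uncurry (g i))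
  memLp : ∀ i x, MemLp (fun s => g i s x) 2 law
  mean_mem : ∀ i x, ∫ s, g i s x ∂law ∈ T i x
  variance_le : ∀ i x, ∫ s, ‖g i s x - ∫ s', g i s' x ∂law‖ ^ 2 ∂law ≤ σ ^ 2

/-! ### The algorithm -/

/-- The parameter sequences of the algorithm, and the constant `ryz` of the coupling function
`G(y, z) = (ryz / 2) ‖y + z‖²`. -/
structure Params where
  (alpha beta gamma sigma lam taux etax etay etaz thetaz : ℕ → ℝ)
  ryz : ℝ

/-- The parameters are in the range that the algorithm prescribes. -/
structure Params.Valid (q : Params) : Prop where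
  alpha : ∀ k, 0 ≤ q.alpha k
  beta : ∀ k, 0 ≤ q.beta k
  gamma : ∀ k, 0 ≤ q.gamma k
  sigma : ∀ k, 0 ≤ q.sigma k
  lam : ∀ k, 0 ≤ q.lam k
  taux : ∀ k, 0 ≤ q.taux k
  etax : ∀ k, 0 ≤ q.etax k
  etay : ∀ k, 0 ≤ q.etay k
  etaz : ∀ k, 0 ≤ q.etaz k
  thetaz : ∀ k, 0 ≤ q.thetaz k
  ryz : 0 < q.ryz

/-- The input of the algorithm: `x⁰`, `y⁰`, `m⁰ ∈ Hⁿ` and `z⁰ ∈ Hⁿ` with `∑ i, z⁰ i = 0`. -/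
structure Input (n : ℕ) (H : Type*) [AddCommGroup H] where
  (x y z m : Fin n → H)
  z_sum : ∑ i, z i = 0

/-- The variables held at the start of outer iteration `k`: `x^k`, `x^(k-1)`, `x̃^k`, `x̄^k`, `y^k`,
`ȳ^k`, `z^k`, `z̄^k`, `m^k`. -/
structure State (n : ℕ) (H : Type*) where
  (x xprev xtilde xbar y ybar z zbar m : Fin n → H)

section Algorithm

variable {n : ℕ} {H : Type*} [AddCommGroup H] [Module ℝ H]

/-- `(A ⊗ I) v`: one communication with the gossip matrix `A`. -/
def gossip (A : Matrix (Fin n) (Fin n) ℝ) (v : Fin n → H) : Fin n → H :=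
  fun i => ∑ j, A i j • v j

/-- The inner step: the solution `u⁺` of the implicit equation
`u⁺ = u - η (g + β u⁺ - y + τ (u⁺ - x))`. -/
def innerStep (η β τ : ℝ) (g y x u : Fin n → H) : Fin n → H :=
  (1 + η * (β + τ))⁻¹ • (u - η • (g - y - τ • x))

theorem innerStep_spec {η β τ : ℝ} (hη : 0 ≤ η) (hβ : 0 ≤ β) (hτ : 0 ≤ τ)
    (g y x u : Fin n → H) :
    innerStep η β τ g y x u =
      u - η • (g + β • innerStep η β τ g y x u - y + τ • (innerStep η β τ g y x u - x)) := by
  have h : (1 + η * (β + τ)) ≠ 0 := by positivity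
  have h1 : (1 + η * (β + τ)) • innerStep η β τ g y x u = u - η • (g - y - τ • x) := by
    rw [innerStep, smul_smul, mul_inv_cancel₀ h, one_smul]
  generalize innerStep η β τ g y x u = v at h1 ⊢
  have h2 : v = (1 + η * (β + τ)) • v - (η * (β + τ)) • v := by module
  calc v = (1 + η * (β + τ)) • v - (η * (β + τ)) • v := h2
    _ = (u - η • (g - y - τ • x)) - (η * (β + τ)) • v := by rw [h1]
    _ = _ := by module

/-- `x^(k,t)`: the inner iterates, from `x^(k,0) = x`. All nodes `i` call their oracles at
their own points `x_i^(k,t)`; `ω t` is the joint seed of the inner iteration `t`. -/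
def innerIterate {S : Type*} (g : Fin n → S → H → H) (η β τ : ℝ) (x ynew : Fin n → H)
    (ω : ℕ → S) : ℕ → Fin n → H
  | 0 => x
  | t + 1 =>
    let u := innerIterate g η β τ x ynew ω t
    innerStep η β τ (fun i => g i (ω t) (u i)) ynew x u

/-- The outer iteration `k`, with `A` the gossip matrix at the time of its communication and
`ω t` the seed of its inner iteration `t`. -/
def outerStep {S : Type*} (q : Params) (T : ℕ) (g : Fin n → S → H → H) (k : ℕ)
    (A : Matrix (Fin n) (Fin n) ℝ) (ω : ℕ → S) (s : State n H) : State n H :=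
  let ylin := q.alpha k • s.y + (1 - q.alpha k) • s.ybar
  let zlin := q.alpha k • s.z + (1 - q.alpha k) • s.zbar
  -- the partial gradients of `G(y, z) = (ryz / 2) ‖y + z‖²` at `(ylin, zlin)`
  let gy := q.ryz • (ylin + zlin)
  let gz := q.ryz • (ylin + zlin)
  let gztilde := gossip A gz
  let gzhat := gossip A (gz + s.m)
  let xhat := s.x + q.gamma k • (s.xtilde - s.xprev)
  let ynew := s.y - q.etay k • (gy + xhat)
  let znew := s.z - q.etaz k • gzhat
  let inner := innerIterate g (q.etax k) (q.beta k) (q.taux k) s.x ynew ω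
  let xtildenew := (1 / (T : ℝ)) • ∑ t ∈ Finset.Icc 1 T, inner t
  { x := q.sigma k • inner T + (1 - q.sigma k) • xtildenew
    xprev := s.x
    xtilde := xtildenew
    xbar := q.alpha k • xtildenew + (1 - q.alpha k) • s.xbar
    y := ynew
    ybar := ylin + q.alpha k • (ynew - s.y)
    z := znew
    zbar := zlin - q.thetaz k • gztilde
    m := (q.etaz k / q.etaz (k + 1)) • (s.m + gz - gzhat) }

/-- The state at the start of outer iteration `k`. The outer iteration `k` communicates at the
time `τ k`, and its inner iteration `t` uses the seed `ω (k, t)`. -/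
def run {S : Type*} (q : Params) (T : ℕ) (I : Input n H) (g : Fin n → S → H → H)
    (W : ℝ≥0 → Matrix (Fin n) (Fin n) ℝ) (τ : ℕ → ℝ≥0) (ω : ℕ × ℕ → S) : ℕ → State n H
  | 0 => ⟨I.x, I.x, I.x, I.x, I.y, I.y, I.z, I.z, I.m⟩
  | k + 1 => outerStep q T g k (W (τ k)) (fun t => ω (k, t)) (run q T I g W τ ω k)

/-- The output `x_o^K` after `K` outer iterations: the average over the nodes of
`(∑_{k=1}^K λ_k)⁻¹ ∑_{k=1}^K λ_k x̄^k`. -/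
def output {S : Type*} (q : Params) (K T : ℕ) (I : Input n H) (g : Fin n → S → H → H)
    (W : ℝ≥0 → Matrix (Fin n) (Fin n) ℝ) (τ : ℕ → ℝ≥0) (ω : ℕ × ℕ → S) : H :=
  let xa : Fin n → H := (∑ k ∈ Finset.Icc 1 K, q.lam k)⁻¹ •
    ∑ k ∈ Finset.Icc 1 K, q.lam k • (run q T I g W τ ω k).xbar
  (1 / (n : ℝ)) • ∑ i, xa i

end Algorithm

/-- The number of decentralized communication rounds in `K` outer iterations with `T` inner
iterations each. -/
def numCommunications (K _T : ℕ) : ℕ := K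

/-- The number of stochastic oracle calls (of every node) in `K` outer iterations with `T` inner
iterations each. -/
def numOracleCalls (K T : ℕ) : ℕ := K * T

/-- The expected gap of the output, where the seeds of all inner iterations are independent with
distribution `law`. -/
def expectedGap {n : ℕ} {H S : Type*} [AddCommGroup H] [Module ℝ H] [MeasurableSpace S]
    (gap : H → ℝ) (law : Measure S) [IsProbabilityMeasure law] (q : Params) (K T : ℕ)
    (I : Input n H) (g : Fin n → S → H → H) (W : ℝ≥0 → Matrix (Fin n) (Fin n) ℝ)
    (τ : ℕ → ℝ≥0) : ℝ :=
  ∫ ω, gap (output q K T I g W τ ω) ∂(Measure.infinitePi (fun _ : ℕ × ℕ => law))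

/-- For all `K`, `T` and all parameters, reaching expected gap at most `ε` takes the algorithm at
least `Ncomm` communications and at least `Ncall` oracle calls. -/
def RequiresAtLeast {n : ℕ} {H S : Type*} [AddCommGroup H] [Module ℝ H] [MeasurableSpace S]
    (gap : H → ℝ) (law : Measure S) [IsProbabilityMeasure law] (I : Input n H)
    (g : Fin n → S → H → H) (W : ℝ≥0 → Matrix (Fin n) (Fin n) ℝ) (τ : ℕ → ℝ≥0)
    (ε Ncomm Ncall : ℝ) : Prop :=
  ∀ (K T : ℕ) (q : Params), 1 ≤ K → 1 ≤ T → q.Valid →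
    expectedGap gap law q K T I g W τ ≤ ε →
      Ncomm ≤ numCommunications K T ∧ Ncall ≤ numOracleCalls K T

end DecOpt

end

noncomputable section

namespace DecOpt

/-! ### Functions with a selection of subgradients -/

section Subgradient

variable {E : Type*} [NormedAddCommGroup E] [InnerProductSpace ℝ E]

/-! The hard objective is a resisting-oracle construction with two independent chains of orthonormal
directions, both orthogonal to the input. Every variable of the algorithm is built from the input,
the oracle answers and the gossip products by linear combinations. A direction that has not been
revealed therefore has coefficient zero in the output, and a missing direction forces a large gap.

The communication bound comes from the chain `e`. The objective penalizes the links `⟪e j - e (j-1),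
x⟫`, whose first one has target `b`. Even links belong to nodes of class 0, odd links to class 1,
and class 2 owns none and only relays. A node whose next link is not its own learns nothing by
computing, however often it calls its oracle (`grad_mem_level_e`). The network is a star whose
centre runs through the `m` nodes of class 2. The centre hears everybody but passes on only what it
knew before, so news from one class reaches the other only when an informed relay becomes the centre
again, one cycle of `m` communications later. `reach` records this,
`reach_le_of_gossipMatrix_ne_zero` checks it, and about `m * D` communications are needed, with `m`
of order `χ` and `D` of order `MR/ε`.

The oracle bound comes from the chain `w`, on which every node has the term `a' * max_j |⟪w j, x⟫ -
b'|`. With ties broken towards the smallest index, a subgradient reveals at most one new direction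
(`grad_mem_level_w`). The oracle tosses one coin for all nodes: with probability `p = M²/(M²+σ²)` it
returns the subgradient divided by `p`, otherwise `0`. Revealing `D'` directions takes `D'`
successes, so a Markov argument gives `KT ≥ D'/(2p)`, with `D'` of order `(MR/ε)²`.

`outerStep_within` turns these local facts into invariants of the run, `Chain.requiresAtLeast`
combines them, and `exists_chain` fixes the constants. The saddle point case uses the same function
with a dummy variable `ζ`. -/

theorem convexOn_of_forall_mem_subdiff {f : E → ℝ} {G : E → E} (hG : ∀ x, G x ∈ subdiff f x) :
    ConvexOn ℝ Set.univ f := by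
  refine ⟨convex_univ, fun x _ y _ a b ha hb hab => ?_⟩
  set z := a • x + b • y with hz
  have h1 := mul_le_mul_of_nonneg_left (hG z x) ha
  have h2 := mul_le_mul_of_nonneg_left (hG z y) hb
  have h3 : a * inner ℝ (G z) (x - z) + b * inner ℝ (G z) (y - z) = 0 := by
    rw [← real_inner_smul_right, ← real_inner_smul_right, ← inner_add_right]
    have : a • (x - z) + b • (y - z) = (a • x + b • y) - (a + b) • z := by module
    rw [this, hab, one_smul, ← hz, sub_self, inner_zero_right]
  have h4 : a * f z + b * f z = f z := by rw [← add_mul, hab, one_mul]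
  simp only [smul_eq_mul]
  linarith

/-- Comparing the subgradient inequality for `g` at `x` with that for `G` at `x + g` gives `‖g‖² ≤
⟪G (x + g), g⟫`. Thus bounding a single selection bounds the whole subdifferential, as
`OperatorBound` demands. -/
theorem norm_le_of_mem_subdiff {f : E → ℝ} {G : E → E} {M : ℝ} (hG : ∀ x, G x ∈ subdiff f x)
    (hM : ∀ x, ‖G x‖ ≤ M) {x g : E} (hg : g ∈ subdiff f x) : ‖g‖ ≤ M := by
  have h1 := hg (x + g)
  have h2 := hG (x + g) x
  rw [add_sub_cancel_left, real_inner_self_eq_norm_sq] at h1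
  rw [sub_add_cancel_left, inner_neg_right] at h2
  have h3 : inner ℝ (G (x + g)) g ≤ M * ‖g‖ :=
    (real_inner_le_norm _ _).trans (mul_le_mul_of_nonneg_right (hM _) (norm_nonneg g))
  rcases (norm_nonneg g).eq_or_lt with h | h
  · rw [← h]; exact (norm_nonneg _).trans (hM x)
  · exact le_of_mul_le_mul_right (by nlinarith) h

theorem norm_sq_sum_smul_le {v : ℕ → E} (horth : Pairwise fun i j => inner ℝ (v i) (v j) = 0)
    (hnorm : ∀ j, ‖v j‖ ≤ 1) {c : ℕ → ℝ} {B : ℝ} (hc : ∀ j, |c j| ≤ B) (D : ℕ) :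
    ‖∑ j ∈ Finset.range D, c j • v j‖ ^ 2 ≤ D * B ^ 2 := by
  induction D with
  | zero => simp
  | succ D ih =>
    have h0 : inner ℝ (∑ j ∈ Finset.range D, c j • v j) (c D • v D) = 0 := by
      rw [sum_inner]
      refine Finset.sum_eq_zero fun j hj => ?_
      rw [real_inner_smul_left, real_inner_smul_right, horth (Finset.mem_range.1 hj).ne]
      simp
    have h1 : ‖c D • v D‖ ≤ B := by
      rw [norm_smul, Real.norm_eq_abs]
      nlinarith [hc D, hnorm D, norm_nonneg (v D), abs_nonneg (c D)]
    rw [Finset.sum_range_succ, norm_add_sq_real, h0, Nat.cast_succ]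
    nlinarith [norm_nonneg (c D • v D)]

theorem norm_sum_smul_le {v : ℕ → E} (horth : Pairwise fun i j => inner ℝ (v i) (v j) = 0)
    (hnorm : ∀ j, ‖v j‖ ≤ 1) {c : ℕ → ℝ} {B : ℝ} (hc : ∀ j, |c j| ≤ B) (D : ℕ) :
    ‖∑ j ∈ Finset.range D, c j • v j‖ ≤ B * √D := by
  have hB : 0 ≤ B := (abs_nonneg _).trans (hc 0)
  refine abs_le_of_sq_le_sq' ?_ (by positivity) |>.2
  rw [mul_pow, Real.sq_sqrt (Nat.cast_nonneg D), mul_comm]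
  exact norm_sq_sum_smul_le horth hnorm hc D

end Subgradient

/-! ### The sign function as a subgradient of the absolute value. -/

theorem sign_mul_self_eq_abs (s : ℝ) : Real.sign s * s = |s| := by
  rcases lt_trichotomy s 0 with h | h | h
  · simp [Real.sign_of_neg h, abs_of_neg h]
  · simp [h]
  · simp [Real.sign_of_pos h, abs_of_pos h]

theorem abs_sign_le_one (s : ℝ) : |Real.sign s| ≤ 1 := by
  rcases Real.sign_apply_eq s with h | h | h <;> simp [h]

theorem sign_mul_le_abs (s t : ℝ) : Real.sign s * t ≤ |t| := by
  refine (le_abs_self _).trans ?_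
  rw [abs_mul]
  exact mul_le_of_le_one_left (abs_nonneg t) (abs_sign_le_one s)

/-- At the kink the selected subgradient is `Real.sign 0 = 0`. This choice is what keeps links with
zero residual silent in `grad_mem_level_e`. -/
theorem abs_add_sign_mul_sub_le (s t : ℝ) : |s| + Real.sign s * (t - s) ≤ |t| := by
  have h1 := sign_mul_self_eq_abs s
  have h2 := sign_mul_le_abs s t
  linarith [mul_sub (Real.sign s) t s]

theorem measurable_real_sign : Measurable Real.sign :=
  Measurable.ite measurableSet_Iio measurable_const
    (Measurable.ite measurableSet_Ioi measurable_const measurable_const)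

/-! ### The hard functions -/

/-- The data of a hard function: a chain `e` of directions that two classes of nodes can only
discover in turn, and a chain `w` of directions that every node can only discover one by one. -/
structure Chain (H : Type*) [NormedAddCommGroup H] [InnerProductSpace ℝ H] where
  e : ℕ → H
  w : ℕ → H
  e_orth : Pairwise fun i j => inner ℝ (e i) (e j) = 0
  w_orth : Pairwise fun i j => inner ℝ (w i) (w j) = 0
  cross : ∀ i j, inner ℝ (e i) (w j) = 0
  e_norm : ∀ j, ‖e j‖ ≤ 1
  w_norm : ∀ j, ‖w j‖ ≤ 1
  (D D' : ℕ)
  D'_pos : 0 < D'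
  e_unit : ∀ j < D, ‖e j‖ = 1
  w_unit : ∀ j < D', ‖w j‖ = 1
  (a b a' b' : ℝ)
  a_nonneg : 0 ≤ a
  a'_nonneg : 0 ≤ a'

namespace Chain

variable {H : Type*} [NormedAddCommGroup H] [InnerProductSpace ℝ H] (C : Chain H)

/-- The predecessor of `e j` in the chain, `0` if there is none. -/
def back : ℕ → H
  | 0 => 0
  | j + 1 => C.e j

/-- The residual of the link `j` of the first chain. -/
def res (j : ℕ) (x : H) : ℝ := inner ℝ (C.e j - C.back j) x - if j = 0 then C.b else 0

/-- The deviation of the coordinate `j` along the second chain from its optimal value. -/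
def dev (j : ℕ) (x : H) : ℝ := inner ℝ (C.w j) x - C.b'

/-- The part of the objective of a node of class `c` that involves the first chain. -/
def link (c : ℕ) (x : H) : ℝ :=
  C.a * ∑ j ∈ Finset.range C.D, if j % 2 = c then |C.res j x| else 0

def linkGrad (c : ℕ) (x : H) : H :=
  ∑ j ∈ Finset.range C.D, (C.a * if j % 2 = c then Real.sign (C.res j x) else 0) •
    (C.e j - C.back j)

/-- The part of the objective that involves the second chain. -/
def peak (x : H) : ℝ := C.a' * ‖fun j : Fin C.D' => C.dev j x‖

/-- The coordinate `j` is the first one of largest deviation. -/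
def IsFirst (j : ℕ) (x : H) : Prop :=
  (∀ i : Fin C.D', |C.dev i x| ≤ |C.dev j x|) ∧ ∀ i : Fin j, |C.dev i x| < |C.dev j x|

open scoped Classical in
def peakGrad (x : H) : H :=
  ∑ j ∈ Finset.range C.D', if C.IsFirst j x then (C.a' * Real.sign (C.dev j x)) • C.w j else 0

/-- The objective of a node of class `c`. -/
def fn (c : ℕ) (x : H) : ℝ := C.link c x + C.peak x

/-- A subgradient of the objective of a node of class `c`. -/
def grad (c : ℕ) (x : H) : H := C.linkGrad c x + C.peakGrad x

/-- The average objective if the classes `0`, `1`, `2` are equally large. -/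
def total (x : H) : ℝ := C.a / 3 * ∑ j ∈ Finset.range C.D, |C.res j x| + C.peak x

/-- The minimizer. -/
def sol : H :=
  ∑ j ∈ Finset.range C.D, C.b • C.e j + ∑ j ∈ Finset.range C.D', C.b' • C.w j

theorem exists_isFirst (x : H) : ∃ j < C.D', C.IsFirst j x := by
  classical
  obtain ⟨i, -, hi⟩ := Finset.exists_max_image (Finset.univ : Finset (Fin C.D'))
    (fun j => |C.dev j x|) ⟨⟨0, C.D'_pos⟩, Finset.mem_univ _⟩
  have hex : ∃ j, j < C.D' ∧ ∀ i : Fin C.D', |C.dev i x| ≤ |C.dev j x| :=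
    ⟨i, i.2, fun k => hi k (Finset.mem_univ k)⟩
  have hj := Nat.find_spec hex
  refine ⟨Nat.find hex, hj.1, hj.2, fun k => ?_⟩
  by_contra! hk
  exact Nat.find_min hex k.2 ⟨k.2.trans hj.1, fun l => (hj.2 l).trans hk⟩

theorem IsFirst.eq {x : H} {i j : ℕ} (hi : C.IsFirst i x) (hj : C.IsFirst j x) (hiD : i < C.D')
    (hjD : j < C.D') : i = j := by
  rcases lt_trichotomy i j with h | h | h
  · exact absurd (hj.2 ⟨i, h⟩) (hi.1 ⟨j, hjD⟩).not_gt
  · exact h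
  · exact absurd (hi.2 ⟨j, h⟩) (hj.1 ⟨i, hiD⟩).not_gt

theorem peakGrad_eq {x : H} {j : ℕ} (hjD : j < C.D') (hj : C.IsFirst j x) :
    C.peakGrad x = (C.a' * Real.sign (C.dev j x)) • C.w j := by
  rw [peakGrad, Finset.sum_eq_single_of_mem j (Finset.mem_range.2 hjD), if_pos hj]
  exact fun i hi hij => if_neg fun h => hij (IsFirst.eq C h hj (Finset.mem_range.1 hi) hjD)

theorem peak_eq {x : H} {j : ℕ} (hjD : j < C.D') (hj : C.IsFirst j x) :
    C.peak x = C.a' * |C.dev j x| := by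
  rw [peak]
  congr 1
  refine le_antisymm ((pi_norm_le_iff_of_nonneg (abs_nonneg _)).2 hj.1) ?_
  exact norm_le_pi_norm (fun j : Fin C.D' => C.dev j x) ⟨j, hjD⟩

theorem le_peak {j : ℕ} (hjD : j < C.D') (x : H) : C.a' * |C.dev j x| ≤ C.peak x :=
  mul_le_mul_of_nonneg_left (norm_le_pi_norm (fun j : Fin C.D' => C.dev j x) ⟨j, hjD⟩) C.a'_nonneg

theorem peakGrad_mem_subdiff (x : H) : C.peakGrad x ∈ subdiff C.peak x := by
  intro y
  obtain ⟨j, hjD, hj⟩ := C.exists_isFirst x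
  rw [C.peakGrad_eq hjD hj, C.peak_eq hjD hj, real_inner_smul_left]
  refine le_trans ?_ (C.le_peak hjD y)
  have h := mul_le_mul_of_nonneg_left (abs_add_sign_mul_sub_le (C.dev j x) (C.dev j y))
    C.a'_nonneg
  have h' : C.dev j y - C.dev j x = inner ℝ (C.w j) (y - x) := by
    simp only [dev, inner_sub_right]; ring
  rw [h'] at h
  linarith

theorem linkGrad_mem_subdiff (c : ℕ) (x : H) : C.linkGrad c x ∈ subdiff (C.link c) x := by
  intro y
  simp only [link, linkGrad, sum_inner, Finset.mul_sum, ← Finset.sum_add_distrib]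
  refine Finset.sum_le_sum fun j _ => ?_
  rw [real_inner_smul_left]
  split_ifs
  · have h := mul_le_mul_of_nonneg_left (abs_add_sign_mul_sub_le (C.res j x) (C.res j y))
      C.a_nonneg
    have h' : C.res j y - C.res j x = inner ℝ (C.e j - C.back j) (y - x) := by
      simp only [res, inner_sub_right]; ring
    rw [h'] at h
    linarith
  · simp

theorem grad_mem_subdiff (c : ℕ) (x : H) : C.grad c x ∈ subdiff (C.fn c) x := by
  intro y
  have h1 := C.linkGrad_mem_subdiff c x y
  have h2 := C.peakGrad_mem_subdiff x y
  simp only [fn, grad, inner_add_left]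
  linarith

theorem back_orth : Pairwise fun i j => inner ℝ (C.back i) (C.back j) = 0 := by
  rintro (_ | i) (_ | j) hij
  · simp [back]
  · simp [back]
  · simp [back]
  · exact C.e_orth (by simpa using hij)

theorem back_norm (j : ℕ) : ‖C.back j‖ ≤ 1 := by
  cases j with
  | zero => simp [back]
  | succ j => exact C.e_norm j

/-- The link directions are not orthogonal to each other, but the `e j` are, and so are the `back
j`. Each of the two families contributes at most `a * √D` by Pythagoras. -/
theorem norm_linkGrad_le (c : ℕ) (x : H) : ‖C.linkGrad c x‖ ≤ 2 * C.a * √C.D := by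
  have hc : ∀ j, |C.a * if j % 2 = c then Real.sign (C.res j x) else 0| ≤ C.a := by
    intro j
    rw [abs_mul, abs_of_nonneg C.a_nonneg]
    refine mul_le_of_le_one_right C.a_nonneg ?_
    split_ifs
    · exact abs_sign_le_one _
    · simp
  simp only [linkGrad, smul_sub, Finset.sum_sub_distrib]
  have h1 := norm_sum_smul_le C.e_orth C.e_norm hc C.D
  have h2 := norm_sum_smul_le C.back_orth C.back_norm hc C.D
  have h3 := norm_sub_le
    (∑ j ∈ Finset.range C.D, (C.a * if j % 2 = c then Real.sign (C.res j x) else 0) • C.e j)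
    (∑ j ∈ Finset.range C.D, (C.a * if j % 2 = c then Real.sign (C.res j x) else 0) • C.back j)
  linarith

theorem norm_peakGrad_le (x : H) : ‖C.peakGrad x‖ ≤ C.a' := by
  obtain ⟨j, hjD, hj⟩ := C.exists_isFirst x
  rw [C.peakGrad_eq hjD hj, norm_smul, Real.norm_eq_abs, abs_mul, abs_of_nonneg C.a'_nonneg,
    mul_assoc]
  exact mul_le_of_le_one_right C.a'_nonneg
    (mul_le_one₀ (abs_sign_le_one _) (norm_nonneg _) (C.w_norm j))

theorem norm_grad_le (c : ℕ) (x : H) : ‖C.grad c x‖ ≤ 2 * C.a * √C.D + C.a' :=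
  (norm_add_le _ _).trans (add_le_add (C.norm_linkGrad_le c x) (C.norm_peakGrad_le x))

/-! The minimizer. -/

theorem inner_e_sol {j : ℕ} (hj : j < C.D) : inner ℝ (C.e j) C.sol = C.b := by
  have h1 : ∀ i, inner ℝ (C.e j) (C.b' • C.w i) = 0 := fun i => by
    rw [real_inner_smul_right, C.cross, mul_zero]
  rw [sol, inner_add_right, inner_sum, inner_sum, Finset.sum_eq_single_of_mem j
    (Finset.mem_range.2 hj), Finset.sum_eq_zero fun i _ => h1 i, real_inner_smul_right,
    real_inner_self_eq_norm_sq, C.e_unit j hj]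
  · simp
  · intro i _ hij
    rw [real_inner_smul_right, C.e_orth hij.symm, mul_zero]

theorem inner_w_sol {j : ℕ} (hj : j < C.D') : inner ℝ (C.w j) C.sol = C.b' := by
  have h1 : ∀ i, inner ℝ (C.w j) (C.b • C.e i) = 0 := fun i => by
    rw [real_inner_smul_right, real_inner_comm, C.cross, mul_zero]
  rw [sol, inner_add_right, inner_sum, inner_sum, Finset.sum_eq_zero fun i _ => h1 i,
    Finset.sum_eq_single_of_mem j (Finset.mem_range.2 hj), real_inner_smul_right,
    real_inner_self_eq_norm_sq, C.w_unit j hj]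
  · simp
  · intro i _ hij
    rw [real_inner_smul_right, C.w_orth hij.symm, mul_zero]

theorem res_sol {j : ℕ} (hj : j < C.D) : C.res j C.sol = 0 := by
  rw [res, inner_sub_left, C.inner_e_sol hj]
  cases j with
  | zero => simp [back]
  | succ j => simp [back, C.inner_e_sol (Nat.lt_of_succ_lt hj)]

theorem total_sol : C.total C.sol = 0 := by
  have h : (fun j : Fin C.D' => C.dev j C.sol) = 0 := by
    ext j
    simp [dev, C.inner_w_sol j.2]
  rw [total, peak, h, Finset.sum_eq_zero]
  · simp
  · intro j hj
    rw [C.res_sol (Finset.mem_range.1 hj), abs_zero]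

theorem peak_nonneg (x : H) : 0 ≤ C.peak x := mul_nonneg C.a'_nonneg (norm_nonneg _)

theorem peak_le_total (x : H) : C.peak x ≤ C.total x :=
  le_add_of_nonneg_left (mul_nonneg (div_nonneg C.a_nonneg (by norm_num))
    (Finset.sum_nonneg fun _ _ => abs_nonneg _))

theorem total_nonneg (x : H) : 0 ≤ C.total x := (C.peak_nonneg x).trans (C.peak_le_total x)

theorem norm_sol_le : ‖C.sol‖ ≤ |C.b| * √C.D + |C.b'| * √C.D' :=
  (norm_add_le _ _).trans (add_le_add
    (norm_sum_smul_le C.e_orth C.e_norm (fun _ => le_rfl) C.D)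
    (norm_sum_smul_le C.w_orth C.w_norm (fun _ => le_rfl) C.D'))

/-- The residuals telescope. Hence a vanishing coordinate along `e j` forces the absolute residuals
up to `j` to add up to at least `|b|`. -/
theorem sum_res_range_succ (j : ℕ) (x : H) :
    ∑ i ∈ Finset.range (j + 1), C.res i x = inner ℝ (C.e j) x - C.b := by
  induction j with
  | zero => simp [res, back]
  | succ j ih => rw [Finset.sum_range_succ, ih]; simp [res, back, inner_sub_left]

/-- A point without a component along the last direction of the first chain is far from optimal. -/
theorem le_total_of_inner_e_eq_zero {j : ℕ} (hj : j < C.D) {x : H} (hx : inner ℝ (C.e j) x = 0) :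
    C.a * |C.b| / 3 ≤ C.total x := by
  have h1 : |C.b| ≤ ∑ i ∈ Finset.range C.D, |C.res i x| := by
    have h := C.sum_res_range_succ j x
    rw [hx, zero_sub] at h
    rw [← abs_neg, ← h]
    exact (Finset.abs_sum_le_sum_abs _ _).trans (Finset.sum_le_sum_of_subset_of_nonneg
      (Finset.range_subset_range.2 hj) fun _ _ _ => abs_nonneg _)
  have h2 := mul_le_mul_of_nonneg_left h1 (div_nonneg C.a_nonneg zero_le_three)
  have h3 := C.peak_nonneg x
  rw [total]
  linarith

/-- A point without a component along the last direction of the second chain is far from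
optimal. -/
theorem le_total_of_inner_w_eq_zero {j : ℕ} (hj : j < C.D') {x : H} (hx : inner ℝ (C.w j) x = 0) :
    C.a' * |C.b'| ≤ C.total x := by
  have h := (C.le_peak hj x).trans (C.peak_le_total x)
  rwa [dev, hx, zero_sub, abs_neg] at h

theorem sum_range_three_mul_mod (m : ℕ) (f : ℕ → ℝ) :
    ∑ i ∈ Finset.range (3 * m), f (i % 3) = m * (f 0 + f 1 + f 2) := by
  induction m with
  | zero => simp
  | succ m ih =>
    rw [show 3 * (m + 1) = 3 * m + 1 + 1 + 1 by ring, Finset.sum_range_succ,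
      Finset.sum_range_succ, Finset.sum_range_succ, ih, show 3 * m % 3 = 0 by lia,
      show (3 * m + 1) % 3 = 1 by lia, show (3 * m + 1 + 1) % 3 = 2 by lia]
    push_cast
    ring

/-- Each link is held by exactly one of the three classes, whence the factor `1/3` in `total`; the
peak is held by all three. -/
theorem average_fn_eq_total {m : ℕ} (hm : 0 < m) (x : H) :
    1 / ((3 * m : ℕ) : ℝ) * ∑ i : Fin (3 * m), C.fn (i % 3) x = C.total x := by
  rw [Fin.sum_univ_eq_sum_range (fun i => C.fn (i % 3) x),
    sum_range_three_mul_mod m (fun c => C.fn c x)]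
  have h0 : C.link 0 x + C.link 1 x = C.a * ∑ j ∈ Finset.range C.D, |C.res j x| := by
    rw [link, link, ← mul_add, ← Finset.sum_add_distrib]
    congr 1
    refine Finset.sum_congr rfl fun j _ => ?_
    rcases Nat.mod_two_eq_zero_or_one j with h | h <;> simp [h]
  have h2 : C.link 2 x = 0 := by
    rw [link, Finset.sum_eq_zero, mul_zero]
    exact fun j _ => if_neg (by lia)
  have hm' : (m : ℝ) ≠ 0 := by positivity
  rw [total, fn, fn, fn, h2]
  push_cast
  field_simp
  linarith

/-! The points with no component beyond a certain place of a chain. -/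

/-- The vectors without components along `v l` for `l ≥ L`. -/
def level (v : ℕ → H) (L : ℕ) : Submodule ℝ H where
  carrier := {x | ∀ l, L ≤ l → inner ℝ (v l) x = 0}
  add_mem' hx hy l hl := by rw [inner_add_right, hx l hl, hy l hl, add_zero]
  zero_mem' l _ := inner_zero_right _
  smul_mem' c x hx l hl := by rw [real_inner_smul_right, hx l hl, mul_zero]

theorem level_mono (v : ℕ → H) : Monotone (level v) :=
  fun _ _ h _ hx l hl => hx l (h.trans hl)

theorem inner_w_back (l j : ℕ) : inner ℝ (C.w l) (C.back j) = 0 := by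
  cases j with
  | zero => simp [back]
  | succ j => rw [back, real_inner_comm, C.cross]

theorem linkGrad_mem_level_w (c L : ℕ) (x : H) : C.linkGrad c x ∈ level C.w L := by
  refine Submodule.sum_mem _ fun j _ => Submodule.smul_mem _ _ fun l _ => ?_
  rw [inner_sub_right, real_inner_comm, C.cross, C.inner_w_back, sub_zero]

theorem peakGrad_mem_level_e (L : ℕ) (x : H) : C.peakGrad x ∈ level C.e L := by
  obtain ⟨j, hjD, hj⟩ := C.exists_isFirst x
  rw [C.peakGrad_eq hjD hj]
  exact Submodule.smul_mem _ _ fun l _ => C.cross l j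

/-- One subgradient reveals at most one new direction of the second chain. -/
theorem grad_mem_level_w {c L : ℕ} {x : H} (hx : x ∈ level C.w L) :
    C.grad c x ∈ level C.w (L + 1) := by
  refine Submodule.add_mem _ (C.linkGrad_mem_level_w c _ x) ?_
  obtain ⟨j, hjD, hj⟩ := C.exists_isFirst x
  rw [C.peakGrad_eq hjD hj]
  -- All coordinates from `L` on have the same deviation `-b'`, so the first maximizer cannot lie
  -- strictly beyond `L`.
  refine Submodule.smul_mem _ _ fun l hl => C.w_orth fun hlj => ?_
  subst hlj
  have h := hj.2 ⟨L, hl⟩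
  rw [dev, dev, hx L le_rfl, hx l (Nat.le_of_succ_le hl)] at h
  exact lt_irrefl _ h

/-- A node cannot reveal any new direction of the first chain if the next link is not its own. -/
theorem grad_mem_level_e {c L : ℕ} (hL : L % 2 ≠ c) {x : H} (hx : x ∈ level C.e L) :
    C.grad c x ∈ level C.e L := by
  refine Submodule.add_mem _ (Submodule.sum_mem _ fun j _ => ?_) (C.peakGrad_mem_level_e L x)
  rcases lt_trichotomy j L with h | h | h
  · refine Submodule.smul_mem _ _ fun l hl => ?_
    rw [inner_sub_right, C.e_orth (h.trans_le hl).ne']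
    cases j with
    | zero => simp [back]
    | succ j => rw [back, C.e_orth ((Nat.lt_of_succ_lt h).trans_le hl).ne', sub_zero]
  -- The link `L` is the only one that could reveal `e L`, and it belongs to another class.
  · rw [h, if_neg hL, mul_zero, zero_smul]
    exact Submodule.zero_mem _
  -- Later links join two coordinates that both vanish. They are not the link `0`, so their target
  -- is `0` and their sign is `0`.
  · obtain ⟨i, rfl⟩ : ∃ i, j = i + 1 := ⟨j - 1, by lia⟩
    have : C.res (i + 1) x = 0 := by
      simp [res, back, inner_sub_left, hx (i + 1) h.le, hx i (Nat.le_of_lt_succ h)]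
    rw [this, Real.sign_zero, ite_self, mul_zero, zero_smul]
    exact Submodule.zero_mem _

theorem measurable_grad [MeasurableSpace H] [BorelSpace H] [SecondCountableTopology H] (c : ℕ) :
    Measurable (C.grad c) := by
  have hres : ∀ j, Measurable (C.res j) := fun j =>
    (Continuous.measurable (by fun_prop)).sub_const _
  have hdev : ∀ j, Measurable fun x => |C.dev j x| := fun j =>
    Continuous.measurable (by unfold dev; fun_prop)
  have hdev' : ∀ j, Measurable (C.dev j) := fun j =>
    Continuous.measurable (by unfold dev; fun_prop)
  refine Measurable.add ?_ ?_
  · refine Finset.measurable_fun_sum _ fun j _ => Measurable.smul_const ?_ _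
    refine Measurable.const_mul ?_ _
    split_ifs
    · exact measurable_real_sign.comp (hres j)
    · exact measurable_const
  · refine Finset.measurable_fun_sum _ fun j _ => Measurable.ite ?_ ?_ measurable_const
    · have : {x | C.IsFirst j x} =
          (⋂ i : Fin C.D', {x | |C.dev i x| ≤ |C.dev j x|}) ∩
            ⋂ i : Fin j, {x | |C.dev i x| < |C.dev j x|} := by
        ext x; simp [IsFirst]
      rw [this]
      exact (MeasurableSet.iInter fun i : Fin C.D' => measurableSet_le (hdev i) (hdev j)).inter
        (MeasurableSet.iInter fun i : Fin j => measurableSet_lt (hdev i) (hdev j))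
    · exact ((measurable_real_sign.comp (hdev' j)).const_mul _).smul_const _

end Chain

/-! ### Invariant subspaces of the algorithm -/

section Invariant

variable {n : ℕ} {H : Type*} [AddCommGroup H] [Module ℝ H]

/-- All variables of the node `i` lie in `P i`. -/
structure State.Within (s : State n H) (P : Fin n → Submodule ℝ H) : Prop where
  x : ∀ i, s.x i ∈ P i
  xprev : ∀ i, s.xprev i ∈ P i
  xtilde : ∀ i, s.xtilde i ∈ P i
  xbar : ∀ i, s.xbar i ∈ P i
  y : ∀ i, s.y i ∈ P i
  ybar : ∀ i, s.ybar i ∈ P i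
  z : ∀ i, s.z i ∈ P i
  zbar : ∀ i, s.zbar i ∈ P i
  m : ∀ i, s.m i ∈ P i

theorem State.Within.mono {s : State n H} {P Q : Fin n → Submodule ℝ H} (h : s.Within P)
    (hPQ : ∀ i, P i ≤ Q i) : s.Within Q :=
  ⟨fun i => hPQ i (h.x i), fun i => hPQ i (h.xprev i), fun i => hPQ i (h.xtilde i),
    fun i => hPQ i (h.xbar i), fun i => hPQ i (h.y i), fun i => hPQ i (h.ybar i),
    fun i => hPQ i (h.z i), fun i => hPQ i (h.zbar i), fun i => hPQ i (h.m i)⟩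

theorem gossip_mem {A : Matrix (Fin n) (Fin n) ℝ} {P Q : Fin n → Submodule ℝ H}
    (hA : ∀ i j, A i j ≠ 0 → P j ≤ Q i) {v : Fin n → H} (hv : ∀ j, v j ∈ P j) (i : Fin n) :
    gossip A v i ∈ Q i := by
  refine Submodule.sum_mem _ fun j _ => ?_
  by_cases h : A i j = 0
  · rw [h, zero_smul]; exact Submodule.zero_mem _
  · exact Submodule.smul_mem _ _ (hA i j h (hv j))

variable {S : Type*}

theorem innerIterate_mem {g : Fin n → S → H → H} {η β τ : ℝ} {x ynew : Fin n → H} {ω : ℕ → S}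
    {T : ℕ} {Q : ℕ → Fin n → Submodule ℝ H} (hQ : ∀ t i, Q t i ≤ Q (t + 1) i)
    (hx : ∀ i, x i ∈ Q 0 i) (hy : ∀ i, ynew i ∈ Q 0 i)
    (hg : ∀ t < T, ∀ i, ∀ u ∈ Q t i, g i (ω t) u ∈ Q (t + 1) i) :
    ∀ t ≤ T, ∀ i, innerIterate g η β τ x ynew ω t i ∈ Q t i := by
  intro t
  induction t with
  | zero => exact fun _ => hx
  | succ t ih =>
    intro ht i
    have hmono : Q 0 i ≤ Q (t + 1) i := monotone_nat_of_le_succ (fun t => hQ t i) (Nat.zero_le _)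
    have hu := ih (Nat.le_of_succ_le ht) i
    simp only [innerIterate, innerStep, Pi.smul_apply, Pi.sub_apply]
    exact Submodule.smul_mem _ _ (Submodule.sub_mem _ (hQ t i hu) (Submodule.smul_mem _ _
      (Submodule.sub_mem _ (Submodule.sub_mem _ (hg t ht i _ hu) (hmono (hy i)))
        (Submodule.smul_mem _ _ (hmono (hx i))))))

/-- Only gossip and oracle answers leave the span of a node's own variables. `Q 0` must absorb what
the neighbours send, and `Q t` grows with the oracle answers of the inner iterations. For the chain
`e` the growth is in `Q 0`, for the chain `w` it is in `t`. -/
theorem outerStep_within {q : Params} {T k : ℕ} {g : Fin n → S → H → H}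
    {A : Matrix (Fin n) (Fin n) ℝ} {ω : ℕ → S} {s : State n H} {P : Fin n → Submodule ℝ H}
    {Q : ℕ → Fin n → Submodule ℝ H} (hs : s.Within P) (hPQ : ∀ i, P i ≤ Q 0 i)
    (hA : ∀ i j, A i j ≠ 0 → P j ≤ Q 0 i) (hQ : ∀ t i, Q t i ≤ Q (t + 1) i)
    (hg : ∀ t < T, ∀ i, ∀ u ∈ Q t i, g i (ω t) u ∈ Q (t + 1) i) :
    (outerStep q T g k A ω s).Within (Q T) := by
  have hmono : ∀ i, Monotone fun t => Q t i := fun i => monotone_nat_of_le_succ fun t => hQ t i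
  have hle : ∀ i, P i ≤ Q T i := fun i => (hPQ i).trans (hmono i (Nat.zero_le T))
  have hAT : ∀ i j, A i j ≠ 0 → P j ≤ Q T i := fun i j h =>
    (hA i j h).trans (hmono i (Nat.zero_le T))
  have comb : ∀ {V : Submodule ℝ H} (c d : ℝ) {u v : H}, u ∈ V → v ∈ V → c • u + d • v ∈ V :=
    fun c d _ _ hu hv => Submodule.add_mem _ (Submodule.smul_mem _ c hu) (Submodule.smul_mem _ d hv)
  have hylin : ∀ i, q.alpha k • s.y i + (1 - q.alpha k) • s.ybar i ∈ P i := fun i =>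
    comb _ _ (hs.y i) (hs.ybar i)
  have hzlin : ∀ i, q.alpha k • s.z i + (1 - q.alpha k) • s.zbar i ∈ P i := fun i =>
    comb _ _ (hs.z i) (hs.zbar i)
  have hgz : ∀ i, q.ryz • ((q.alpha k • s.y i + (1 - q.alpha k) • s.ybar i) +
      (q.alpha k • s.z i + (1 - q.alpha k) • s.zbar i)) ∈ P i := fun i =>
    Submodule.smul_mem _ _ (Submodule.add_mem _ (hylin i) (hzlin i))
  have hynew : ∀ i, s.y i - q.etay k • (q.ryz • ((q.alpha k • s.y i + (1 - q.alpha k) • s.ybar i) +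
      (q.alpha k • s.z i + (1 - q.alpha k) • s.zbar i)) +
      (s.x i + q.gamma k • (s.xtilde i - s.xprev i))) ∈ P i := fun i =>
    Submodule.sub_mem _ (hs.y i) (Submodule.smul_mem _ _ (Submodule.add_mem _ (hgz i)
      (Submodule.add_mem _ (hs.x i) (Submodule.smul_mem _ _
        (Submodule.sub_mem _ (hs.xtilde i) (hs.xprev i))))))
  have hgt := gossip_mem hAT hgz
  have hgh := gossip_mem hAT fun i => Submodule.add_mem _ (hgz i) (hs.m i)
  have hinner := innerIterate_mem (η := q.etax k) (β := q.beta k) (τ := q.taux k) hQ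
    (fun i => hPQ i (hs.x i)) (fun i => hPQ i (hynew i)) hg
  have hxt : ∀ i, (1 / (T : ℝ)) • ∑ t ∈ Finset.Icc 1 T, innerIterate g (q.etax k) (q.beta k)
      (q.taux k) s.x (fun i => s.y i - q.etay k • (q.ryz • ((q.alpha k • s.y i +
      (1 - q.alpha k) • s.ybar i) + (q.alpha k • s.z i + (1 - q.alpha k) • s.zbar i)) +
      (s.x i + q.gamma k • (s.xtilde i - s.xprev i)))) ω t i ∈ Q T i := fun i =>
    Submodule.smul_mem _ _ (Submodule.sum_mem _ fun t ht =>
      hmono i (Finset.mem_Icc.1 ht).2 (hinner t (Finset.mem_Icc.1 ht).2 i))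
  constructor
  · intro i
    simp only [outerStep, Pi.add_apply, Pi.smul_apply, Finset.sum_apply]
    exact comb _ _ (hinner T le_rfl i) (hxt i)
  · exact fun i => hle i (hs.x i)
  · intro i
    simp only [outerStep, Pi.smul_apply, Finset.sum_apply]
    exact hxt i
  · intro i
    simp only [outerStep, Pi.add_apply, Pi.smul_apply, Finset.sum_apply]
    exact comb _ _ (hxt i) (hle i (hs.xbar i))
  · exact fun i => hle i (hynew i)
  · exact fun i => hle i (Submodule.add_mem _ (hylin i) (Submodule.smul_mem _ _
      (Submodule.sub_mem _ (hynew i) (hs.y i))))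
  · exact fun i => Submodule.sub_mem _ (hle i (hs.z i)) (Submodule.smul_mem _ _ (hgh i))
  · exact fun i => Submodule.sub_mem _ (hle i (hzlin i)) (Submodule.smul_mem _ _ (hgt i))
  · exact fun i => Submodule.smul_mem _ _ (Submodule.sub_mem _ (hle i
      (Submodule.add_mem _ (hs.m i) (hgz i))) (hgh i))

theorem output_mem {q : Params} {K T : ℕ} {I : Input n H} {g : Fin n → S → H → H}
    {W : ℝ≥0 → Matrix (Fin n) (Fin n) ℝ} {τ : ℕ → ℝ≥0} {ω : ℕ × ℕ → S} {V : Submodule ℝ H}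
    (h : ∀ k ≤ K, (run q T I g W τ ω k).Within fun _ => V) : output q K T I g W τ ω ∈ V := by
  refine Submodule.smul_mem _ _ (Submodule.sum_mem _ fun i _ => ?_)
  simp only [Pi.smul_apply, Finset.sum_apply]
  exact Submodule.smul_mem _ _ (Submodule.sum_mem _ fun k hk =>
    Submodule.smul_mem _ _ ((h k (Finset.mem_Icc.1 hk).2).xbar i))

/-! The output depends on finitely many seeds. -/

theorem innerIterate_congr (g : Fin n → S → H → H) (η β τ : ℝ) (x ynew : Fin n → H)
    {ω ω' : ℕ → S} {T : ℕ} (h : ∀ t < T, ω t = ω' t) :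
    ∀ t ≤ T, innerIterate g η β τ x ynew ω t = innerIterate g η β τ x ynew ω' t := by
  intro t
  induction t with
  | zero => exact fun _ => rfl
  | succ t ih =>
    intro ht
    simp only [innerIterate, ih (Nat.le_of_succ_le ht), h t ht]

theorem outerStep_congr (q : Params) {T : ℕ} (g : Fin n → S → H → H) (k : ℕ)
    (A : Matrix (Fin n) (Fin n) ℝ) {ω ω' : ℕ → S} (s : State n H) (h : ∀ t < T, ω t = ω' t) :
    outerStep q T g k A ω s = outerStep q T g k A ω' s := by
  have h1 := fun η β τ x ynew => innerIterate_congr g η β τ x ynew h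
  have h2 : ∀ η β τ x ynew, ∑ t ∈ Finset.Icc 1 T, innerIterate g η β τ x ynew ω t =
      ∑ t ∈ Finset.Icc 1 T, innerIterate g η β τ x ynew ω' t := fun η β τ x ynew =>
    Finset.sum_congr rfl fun t ht => h1 η β τ x ynew t (Finset.mem_Icc.1 ht).2
  simp only [outerStep, h1 _ _ _ _ _ T le_rfl, h2]

theorem run_congr (q : Params) {T : ℕ} (I : Input n H) (g : Fin n → S → H → H)
    (W : ℝ≥0 → Matrix (Fin n) (Fin n) ℝ) (τ : ℕ → ℝ≥0) {ω ω' : ℕ × ℕ → S} {K : ℕ}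
    (h : ∀ k < K, ∀ t < T, ω (k, t) = ω' (k, t)) :
    ∀ k ≤ K, run q T I g W τ ω k = run q T I g W τ ω' k := by
  intro k
  induction k with
  | zero => exact fun _ => rfl
  | succ k ih =>
    intro hk
    rw [run, run, ih (Nat.le_of_succ_le hk)]
    exact outerStep_congr q g k _ _ (h k hk)

theorem output_congr (q : Params) {K T : ℕ} (I : Input n H) (g : Fin n → S → H → H)
    (W : ℝ≥0 → Matrix (Fin n) (Fin n) ℝ) (τ : ℕ → ℝ≥0) {ω ω' : ℕ × ℕ → S}
    (h : ∀ k < K, ∀ t < T, ω (k, t) = ω' (k, t)) :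
    output q K T I g W τ ω = output q K T I g W τ ω' := by
  have h1 : ∑ k ∈ Finset.Icc 1 K, q.lam k • (run q T I g W τ ω k).xbar =
      ∑ k ∈ Finset.Icc 1 K, q.lam k • (run q T I g W τ ω' k).xbar :=
    Finset.sum_congr rfl fun k hk => by rw [run_congr q I g W τ h k (Finset.mem_Icc.1 hk).2]
  simp only [output, h1]

/-- The output is a function of the `K * T` seeds actually used, hence factors through a finite
discrete space. No regularity of the gap or of the algorithm is needed. -/
theorem integrable_comp_output [MeasurableSpace S] [MeasurableSingletonClass S] [Finite S]
    [Inhabited S] (μ : Measure (ℕ × ℕ → S)) [IsFiniteMeasure μ] (φ : H → ℝ) (q : Params) (K T : ℕ)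
    (I : Input n H) (g : Fin n → S → H → H) (W : ℝ≥0 → Matrix (Fin n) (Fin n) ℝ) (τ : ℕ → ℝ≥0) :
    Integrable (fun ω => φ (output q K T I g W τ ω)) μ := by
  let restr : (ℕ × ℕ → S) → Fin K × Fin T → S := fun ω p => ω (p.1, p.2)
  -- The default value fills in seeds that the output never reads.
  let ext : (Fin K × Fin T → S) → ℕ × ℕ → S := fun v p =>
    if h : p.1 < K ∧ p.2 < T then v (⟨p.1, h.1⟩, ⟨p.2, h.2⟩) else default
  have hm : Measurable restr := measurable_pi_lambda _ fun p => measurable_pi_apply _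
  have h : (fun ω => φ (output q K T I g W τ ω)) =
      (fun v => φ (output q K T I g W τ (ext v))) ∘ restr := by
    ext ω
    refine congrArg φ (output_congr q I g W τ fun k hk t ht => ?_)
    simp [ext, restr, hk, ht]
  rw [h]
  exact Integrable.of_finite.comp_measurable hm

end Invariant

/-! ### The network -/

/-- The Laplacian of the star with centre `c` on `n` nodes, divided by `n`. -/
def starMatrix {n : ℕ} (c : Fin n) : Matrix (Fin n) (Fin n) ℝ := fun i j =>
  (if i = j then 1 else 0) - (if i = c then 1 else 0) * (1 / n) - (if j = c then 1 else 0) * (1 / n)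
    - (if i = j then 1 else 0) * (1 - 1 / n) + (if i = c then 1 else 0) * (if j = c then 1 else 0)

/-- The matrix `I - J / n`, where `J` is the matrix of ones. -/
def completeMatrix (n : ℕ) : Matrix (Fin n) (Fin n) ℝ := fun i j =>
  (if i = j then 1 else 0) - 1 / n

theorem starMatrix_eq_zero {n : ℕ} {c i j : Fin n} (hij : i ≠ j) (hi : i ≠ c) (hj : j ≠ c) :
    starMatrix c i j = 0 := by
  simp [starMatrix, hij, hi, hj]

theorem starMatrix_symm {n : ℕ} (c i j : Fin n) : starMatrix c i j = starMatrix c j i := by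
  simp only [starMatrix, eq_comm (a := i) (b := j)]
  ring

theorem starMatrix_mulVec {n : ℕ} (c : Fin n) (x : Fin n → ℝ) (i : Fin n) :
    (starMatrix c).mulVec x i = x i - (if i = c then 1 else 0) * (1 / n) * ∑ j, x j - x c * (1 / n)
      - x i * (1 - 1 / n) + if i = c then x c else 0 := by
  have h : ∀ j, starMatrix c i j * x j = (if i = j then x j else 0) -
      (if i = c then 1 else 0) * (1 / n) * x j - (if j = c then x j * (1 / n) else 0) -
      (if i = j then x j * (1 - 1 / n) else 0) + (if j = c then (if i = c then x j else 0) else 0) := by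
    intro j
    simp only [starMatrix]
    split_ifs <;> ring
  simp only [Matrix.mulVec, dotProduct, h, Finset.sum_add_distrib, Finset.sum_sub_distrib,
    Finset.sum_ite_eq, Finset.sum_ite_eq', Finset.mem_univ, if_true, ← Finset.mul_sum]

theorem starMatrix_row_sum {n : ℕ} (c i : Fin n) : ∑ j, starMatrix c i j = 0 := by
  have h := starMatrix_mulVec c (fun _ => 1) i
  have hn : (n : ℝ) ≠ 0 := Nat.cast_ne_zero.2 (Fin.pos i).ne'
  simp only [Matrix.mulVec, dotProduct, mul_one] at h
  rw [h]
  simp only [Finset.sum_const, Finset.card_univ, Fintype.card_fin, nsmul_eq_mul, mul_one]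
  split_ifs <;> field_simp <;> ring

/-- On zero-sum vectors the eigenvalues of the matrix lie in `{1/n, 1}`, so its distance to the
identity is at most `1 - 1/n`. In coordinates, the centre entry of `W x - x` vanishes and the others
are `-((1 - s) x i + s x c)`. -/
theorem starMatrix_contraction {n : ℕ} {χ : ℝ} (hχ : (n : ℝ) ≤ χ) (c : Fin n) (x : Fin n → ℝ)
    (hx : ∑ i, x i = 0) :
    ∑ i, ((starMatrix c).mulVec x i - x i) ^ 2 ≤ (1 - 1 / χ) * ∑ i, x i ^ 2 := by
  have hn : (1 : ℝ) ≤ n := Nat.one_le_cast.2 (Fin.pos c)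
  set s : ℝ := 1 / n with hs
  have hs0 : 0 ≤ s := by positivity
  have hs1 : s ≤ 1 := by rw [hs, div_le_one (by linarith)]; exact hn
  have hsn : s * n = 1 := by rw [hs]; field_simp
  have hsχ : 1 / χ ≤ s := one_div_le_one_div_of_le (by linarith) hχ
  have h : ∀ i, ((starMatrix c).mulVec x i - x i) ^ 2 = (1 - s) ^ 2 * x i ^ 2 +
      2 * (1 - s) * s * x c * x i + s ^ 2 * x c ^ 2 - if i = c then x c ^ 2 else 0 := by
    intro i
    rw [starMatrix_mulVec, hx]
    split_ifs with hi
    · rw [hi]; ring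
    · ring
  have hsum : ∑ i, ((starMatrix c).mulVec x i - x i) ^ 2 =
      (1 - s) ^ 2 * ∑ i, x i ^ 2 + s * x c ^ 2 - x c ^ 2 := by
    simp only [h, Finset.sum_add_distrib, Finset.sum_sub_distrib, ← Finset.mul_sum, hx,
      Finset.sum_ite_eq', Finset.mem_univ, if_true, Finset.sum_const, Finset.card_univ,
      Fintype.card_fin, nsmul_eq_mul]
    linear_combination s * x c ^ 2 * hsn
  have hN : 0 ≤ ∑ i, x i ^ 2 := Finset.sum_nonneg fun i _ => sq_nonneg _
  have h1 : (1 - s) ^ 2 * ∑ i, x i ^ 2 ≤ (1 - 1 / χ) * ∑ i, x i ^ 2 :=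
    mul_le_mul_of_nonneg_right (by nlinarith) hN
  rw [hsum]
  nlinarith [sq_nonneg (x c)]

theorem completeMatrix_mulVec {n : ℕ} (x : Fin n → ℝ) (i : Fin n) :
    (completeMatrix n).mulVec x i = x i - 1 / n * ∑ j, x j := by
  simp only [Matrix.mulVec, dotProduct, completeMatrix, sub_mul, Finset.sum_sub_distrib, ite_mul,
    one_mul, zero_mul, Finset.sum_ite_eq, Finset.mem_univ, if_true, ← Finset.mul_sum]

theorem completeMatrix_row_sum {n : ℕ} (i : Fin n) : ∑ j, completeMatrix n i j = 0 := by
  have h := completeMatrix_mulVec (fun _ => 1) i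
  have hn : (n : ℝ) ≠ 0 := Nat.cast_ne_zero.2 (Fin.pos i).ne'
  simp only [Matrix.mulVec, dotProduct, mul_one] at h
  rw [h]
  simp [hn]

/-- The matrix is the identity on zero-sum vectors, so `χ` may be as small as `1`. It replaces the
star when `m = 1`, where the star on three nodes may contract too slowly for `χ`; only a constant
factor is lost. -/
theorem completeMatrix_contraction {n : ℕ} {χ : ℝ} (hχ : 1 ≤ χ) (x : Fin n → ℝ)
    (hx : ∑ i, x i = 0) :
    ∑ i, ((completeMatrix n).mulVec x i - x i) ^ 2 ≤ (1 - 1 / χ) * ∑ i, x i ^ 2 := by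
  have h : ∀ i, ((completeMatrix n).mulVec x i - x i) ^ 2 = 0 := fun i => by
    rw [completeMatrix_mulVec, hx]; ring
  simp only [h, Finset.sum_const_zero]
  have : 1 / χ ≤ 1 := (div_le_one (by linarith)).2 hχ
  exact mul_nonneg (by linarith) (Finset.sum_nonneg fun i _ => sq_nonneg _)

/-- The node that is the centre of the network at the time of the communication `k`. -/
def center {m : ℕ} (hm : 0 < m) (k : ℕ) : Fin (3 * m) :=
  ⟨3 * (k % m) + 2, by have := Nat.mod_lt k hm; lia⟩

/-- The gossip matrix at the time of the communication `k`: a star with a moving centre. -/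
def gossipMatrix {m : ℕ} (hm : 0 < m) (k : ℕ) : Matrix (Fin (3 * m)) (Fin (3 * m)) ℝ :=
  if m = 1 then completeMatrix (3 * m) else starMatrix (center hm k)

/-- The gossip matrices as a function of time, for communications at the times `τ k`. -/
def network {m : ℕ} (hm : 0 < m) (τ : ℕ → ℝ≥0) (t : ℝ≥0) : Matrix (Fin (3 * m)) (Fin (3 * m)) ℝ :=
  gossipMatrix hm (Function.invFun τ t)

/-- The schedule is injective, so `Function.invFun` recovers the communication index. At other times
the network is still one of the gossip matrices, which is all that the network assumptions need. -/
theorem network_apply {m : ℕ} (hm : 0 < m) {τ : ℕ → ℝ≥0} (hτ : StrictMono τ) (k : ℕ) :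
    network hm τ (τ k) = gossipMatrix hm k := by
  rw [network, Function.leftInverse_invFun hτ.injective k]

theorem networkAssumptions_network {m : ℕ} (hm : 0 < m) {χ : ℝ} (hχ : 1 ≤ χ)
    (hmχ : m ≠ 1 → ((3 * m : ℕ) : ℝ) ≤ χ) (τ : ℕ → ℝ≥0) :
    NetworkAssumptions χ (fun t => {p | network hm τ t p.2 p.1 ≠ 0}) (network hm τ) := by
  refine ⟨fun t i j _ h => by simpa using h, fun t i => ?_, fun t j => ?_, fun t x hx => ?_⟩
  · rw [network, gossipMatrix]
    split_ifs
    · exact completeMatrix_row_sum i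
    · exact starMatrix_row_sum _ i
  · rw [network, gossipMatrix]
    split_ifs
    · refine (Finset.sum_congr rfl fun i _ => ?_).trans (completeMatrix_row_sum j)
      simp only [completeMatrix, eq_comm]
    · exact (Finset.sum_congr rfl fun i _ => starMatrix_symm _ i j).trans (starMatrix_row_sum _ j)
  · rw [network, gossipMatrix]
    split_ifs with h
    · exact completeMatrix_contraction hχ x hx
    · exact starMatrix_contraction (hmχ h) _ x hx

/-- The number of directions of the first chain that the node `i` may know after `k`
communications. -/
def reach (m k i : ℕ) : ℕ :=
  if i % 3 = k / m % 2 ∨ i % 3 = 2 ∧ i / 3 < k % m then k / m + 1 else k / m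

theorem reach_le (m k i : ℕ) : reach m k i ≤ k / m + 1 := by
  unfold reach; split_ifs <;> lia

theorem le_reach (m k i : ℕ) : k / m ≤ reach m k i := by
  unfold reach; split_ifs <;> lia

/-- The invariant that blocks local progress: the first link beyond a node's reach is never its own.
The owner of the link `k / m` already has it counted in. -/
theorem reach_mod_two_ne (m k i : ℕ) : reach m k i % 2 ≠ i % 3 := by
  unfold reach; split_ifs <;> lia

theorem succ_div_mod {m : ℕ} (hm : 0 < m) (k : ℕ) :
    (k % m + 1 < m ∧ (k + 1) / m = k / m ∧ (k + 1) % m = k % m + 1) ∨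
      (k % m + 1 = m ∧ (k + 1) / m = k / m + 1 ∧ (k + 1) % m = 0) := by
  have h1 := Nat.mod_lt k hm
  have h2 := Nat.div_add_mod k m
  rcases (Nat.succ_le_of_lt h1).lt_or_eq with h | h
  · refine Or.inl ⟨h, ?_⟩
    exact (Nat.div_mod_unique hm).2 ⟨by lia, h⟩
  · refine Or.inr ⟨h, ?_⟩
    refine (Nat.div_mod_unique hm).2 ⟨?_, hm⟩
    rw [mul_add, mul_one]; lia

theorem reach_le_succ {m : ℕ} (hm : 0 < m) (k i : ℕ) : reach m k i ≤ reach m (k + 1) i := by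
  rcases succ_div_mod hm k with ⟨-, h2, h3⟩ | ⟨-, h2, -⟩
  · unfold reach; rw [h2, h3]; split_ifs <;> lia
  · have := reach_le m k i
    have := le_reach m (k + 1) i
    lia

/-- A receiving centre is credited with the extra direction from the next step on, whereas a sending
centre has not yet been centre in the current cycle and knows only `k / m` directions. At the end of
a cycle everybody is credited with one more. -/
theorem reach_le_of_gossipMatrix_ne_zero {m : ℕ} (hm : 0 < m) {k : ℕ} {i j : Fin (3 * m)}
    (h : gossipMatrix hm k i j ≠ 0) : reach m k j ≤ reach m (k + 1) i := by
  have h1 := reach_le m k j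
  have h2 := le_reach m (k + 1) i
  have h3 := succ_div_mod hm k
  by_cases hm1 : m = 1
  · have := Nat.mod_lt k hm
    lia
  · by_cases hij : i = j
    · rw [hij]; exact reach_le_succ hm k j
    rw [gossipMatrix, if_neg hm1] at h
    by_cases hi : i = center hm k
    · have h4 : reach m (k + 1) i = (k / m) + 1 ∨ k / m + 1 ≤ (k + 1) / m := by
        rcases h3 with ⟨-, h5, h6⟩ | ⟨-, h5, -⟩
        · left
          rw [reach, h5, h6, hi, if_pos]
          right
          simp only [center]
          lia
        · exact Or.inr h5.ge
      lia
    by_cases hj : j = center hm k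
    · have h4 : reach m k j = k / m := by
        rw [reach, hj, if_neg]
        simp only [center]
        lia
      have h5 : k / m ≤ (k + 1) / m := Nat.div_le_div_right (Nat.le_succ k)
      lia
    · exact absurd (starMatrix_eq_zero hij hi hj) h

/-! ### The oracle -/

/-- The distribution of a seed that is `true` with probability `p`. -/
def coin (p : ℝ) : Measure Bool :=
  ENNReal.ofReal p • Measure.dirac true + ENNReal.ofReal (1 - p) • Measure.dirac false

theorem isProbabilityMeasure_coin {p : ℝ} (hp0 : 0 ≤ p) (hp1 : p ≤ 1) :
    IsProbabilityMeasure (coin p) := by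
  refine ⟨?_⟩
  simp only [coin, Measure.add_apply, Measure.smul_apply, measure_univ, smul_eq_mul, mul_one]
  rw [← ENNReal.ofReal_add hp0 (by linarith), add_sub_cancel, ENNReal.ofReal_one]

theorem integral_coin {p : ℝ} (hp0 : 0 ≤ p) (hp1 : p ≤ 1) {E : Type*} [NormedAddCommGroup E]
    [NormedSpace ℝ E] [CompleteSpace E] (f : Bool → E) :
    ∫ s, f s ∂coin p = p • f true + (1 - p) • f false := by
  rw [coin, integral_add_measure (Integrable.of_finite.smul_measure ENNReal.ofReal_ne_top)
    (Integrable.of_finite.smul_measure ENNReal.ofReal_ne_top), integral_smul_measure,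
    integral_smul_measure, integral_dirac, integral_dirac, ENNReal.toReal_ofReal hp0,
    ENNReal.toReal_ofReal (by linarith)]

namespace Chain

variable {H : Type*} [NormedAddCommGroup H] [InnerProductSpace ℝ H] (C : Chain H)

/-- With probability `p` the oracle answers with a multiple of the subgradient, else with `0`. -/
def oracle (p : ℝ) {n : ℕ} (i : Fin n) (s : Bool) (x : H) : H :=
  (if s then p⁻¹ else 0) • C.grad (i % 3) x

theorem oracleAssumptions [MeasurableSpace H] [BorelSpace H] [SecondCountableTopology H]
    [CompleteSpace H] {n : ℕ} {T : Fin n → H → Set H} {M σ : ℝ} (hM : 0 < M)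
    (hT : ∀ i x, C.grad (i % 3) x ∈ T i x) (hgrad : ∀ c x, ‖C.grad c x‖ ≤ M) :
    OracleAssumptions T σ (coin (M ^ 2 / (M ^ 2 + σ ^ 2))) (C.oracle (M ^ 2 / (M ^ 2 + σ ^ 2))) := by
  set p := M ^ 2 / (M ^ 2 + σ ^ 2) with hp
  have hp0 : 0 < p := by positivity
  have hp1 : p ≤ 1 := (div_le_one (by positivity)).2 (by nlinarith)
  have := isProbabilityMeasure_coin hp0.le hp1
  have hmean : ∀ (i : Fin n) x, ∫ s, C.oracle p i s x ∂coin p = C.grad (i % 3) x := by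
    intro i x
    rw [integral_coin hp0.le hp1]
    simp [oracle, smul_smul, hp0.ne']
  refine ⟨fun i => ?_, fun i x => MemLp.of_discrete, fun i x => ?_, fun i x => ?_⟩
  · exact Measurable.smul ((measurable_of_finite fun s : Bool => if s then p⁻¹ else 0).comp
      measurable_fst) ((C.measurable_grad _).comp measurable_snd)
  · rw [hmean]; exact hT i x
  · rw [hmean, integral_coin hp0.le hp1]
    have h1 : C.oracle p i true x - C.grad (i % 3) x = (p⁻¹ - 1) • C.grad (i % 3) x := by
      rw [oracle, if_pos rfl]; module
    have h2 : ‖C.oracle p i false x - C.grad (i % 3) x‖ = ‖C.grad (i % 3) x‖ := by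
      simp [oracle]
    have h3 : ‖C.grad (i % 3) x‖ ^ 2 ≤ M ^ 2 := by
      gcongr; exact hgrad _ x
    rw [h1, h2, norm_smul, mul_pow, Real.norm_eq_abs, sq_abs]
    -- The variance `(1 - p) / p` of the random multiplier; `p` is chosen to give this value.
    have h4 : p * (p⁻¹ - 1) ^ 2 + (1 - p) = σ ^ 2 / M ^ 2 := by
      rw [hp]; field_simp; ring
    calc p • ((p⁻¹ - 1) ^ 2 * ‖C.grad (i % 3) x‖ ^ 2) + (1 - p) • ‖C.grad (i % 3) x‖ ^ 2
        = (p * (p⁻¹ - 1) ^ 2 + (1 - p)) * ‖C.grad (i % 3) x‖ ^ 2 := by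
          simp only [smul_eq_mul]; ring
      _ ≤ σ ^ 2 / M ^ 2 * M ^ 2 := by
          rw [h4]; gcongr
      _ = σ ^ 2 := by field_simp

end Chain

/-! ### The lower bounds -/

/-- The number of successful oracle calls in the first `k` outer iterations. -/
def successes (T : ℕ) (ω : ℕ × ℕ → Bool) (k : ℕ) : ℕ :=
  ∑ k' ∈ Finset.range k, ∑ t ∈ Finset.range T, if ω (k', t) then 1 else 0

theorem successes_mono (T : ℕ) (ω : ℕ × ℕ → Bool) : Monotone (successes T ω) :=
  fun _ _ h => Finset.sum_le_sum_of_subset (Finset.range_subset_range.2 h)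

theorem integral_successes {p : ℝ} (hp0 : 0 ≤ p) (hp1 : p ≤ 1) [IsProbabilityMeasure (coin p)]
    (K T : ℕ) :
    Integrable (fun ω => (successes T ω K : ℝ)) (Measure.infinitePi fun _ : ℕ × ℕ => coin p) ∧
      ∫ ω, (successes T ω K : ℝ) ∂Measure.infinitePi (fun _ : ℕ × ℕ => coin p) = K * T * p := by
  set μ := Measure.infinitePi (fun _ : ℕ × ℕ => coin p)
  have hmp := fun i => measurePreserving_eval_infinitePi (fun _ : ℕ × ℕ => coin p) i
  have hint : ∀ i, Integrable (fun ω : ℕ × ℕ → Bool => if ω i then (1 : ℝ) else 0) μ := fun i =>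
    (hmp i).integrable_comp_of_integrable
      (g := fun s : Bool => if s then (1 : ℝ) else 0) Integrable.of_finite
  have hval : ∀ i, ∫ ω, (if ω i then (1 : ℝ) else 0) ∂μ = p := by
    intro i
    have h := integral_map (μ := μ) (hmp i).measurable.aemeasurable
      (f := fun s : Bool => if s then (1 : ℝ) else 0) AEStronglyMeasurable.of_discrete
    rw [(hmp i).map_eq, integral_coin hp0 hp1] at h
    simpa using h.symm
  have hcast : ∀ ω : ℕ × ℕ → Bool, (successes T ω K : ℝ) =
      ∑ k ∈ Finset.range K, ∑ t ∈ Finset.range T, if ω (k, t) then (1 : ℝ) else 0 := by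
    intro ω; simp [successes]
  simp only [hcast]
  refine ⟨integrable_finsetSum _ fun k _ => integrable_finsetSum _ fun t _ => hint _, ?_⟩
  rw [integral_finsetSum _ fun k _ => integrable_finsetSum _ fun t _ => hint _]
  simp_rw [integral_finsetSum _ fun t _ => hint _, hval]
  simp [mul_assoc]

/-- The input has no components along the directions `v l`. -/
def Input.Orthogonal {n : ℕ} {H : Type*} [NormedAddCommGroup H] [InnerProductSpace ℝ H]
    (I : Input n H) (v : ℕ → H) : Prop :=
  ∀ i l, inner ℝ (v l) (I.x i) = 0 ∧ inner ℝ (v l) (I.y i) = 0 ∧ inner ℝ (v l) (I.z i) = 0 ∧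
    inner ℝ (v l) (I.m i) = 0

theorem Input.Orthogonal.within {n : ℕ} {H : Type*} [NormedAddCommGroup H] [InnerProductSpace ℝ H]
    {I : Input n H} {v : ℕ → H} (h : I.Orthogonal v) {S : Type*} (q : Params) (T : ℕ)
    (g : Fin n → S → H → H) (W : ℝ≥0 → Matrix (Fin n) (Fin n) ℝ) (τ : ℕ → ℝ≥0) (ω : ℕ × ℕ → S)
    (L : Fin n → ℕ) : (run q T I g W τ ω 0).Within fun i => Chain.level v (L i) :=
  have hx := fun i l (_ : L i ≤ l) => (h i l).1
  have hy := fun i l (_ : L i ≤ l) => (h i l).2.1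
  have hz := fun i l (_ : L i ≤ l) => (h i l).2.2.1
  ⟨hx, hx, hx, hx, hy, hy, hz, hz, fun i l _ => (h i l).2.2.2⟩

namespace Chain

variable {H : Type*} [NormedAddCommGroup H] [InnerProductSpace ℝ H] (C : Chain H) {m : ℕ}
  {I : Input (3 * m) H} {τ : ℕ → ℝ≥0}

/-- By `reach_mod_two_ne` oracle calls gain nothing, so the subspace is constant over the inner
loop, whatever `T` and the seeds are. -/
theorem run_within_e (hm : 0 < m) (hI : I.Orthogonal C.e) (hτ : StrictMono τ) (p : ℝ) (q : Params)
    (T : ℕ) (ω : ℕ × ℕ → Bool) (k : ℕ) :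
    (run q T I (C.oracle p) (network hm τ) τ ω k).Within fun i => level C.e (reach m k i) := by
  induction k with
  | zero => exact hI.within ..
  | succ k ih =>
    refine outerStep_within (Q := fun _ i => level C.e (reach m (k + 1) i)) ih
      (fun i => level_mono _ (reach_le_succ hm k i)) (fun i j hij => ?_) (fun _ _ => le_rfl)
      fun t _ i u hu => Submodule.smul_mem _ _ (C.grad_mem_level_e (reach_mod_two_ne m _ i) hu)
    rw [network_apply hm hτ] at hij
    exact level_mono _ (reach_le_of_gossipMatrix_ne_zero hm hij)

/-- One level serves all nodes, because they share the coin: a success raises it by one everywhere,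
a failure returns `0`. Gossip then cannot raise it, whatever the matrices. -/
theorem run_within_w (hI : I.Orthogonal C.w) (p : ℝ) (W : ℝ≥0 → Matrix (Fin (3 * m)) (Fin (3 * m)) ℝ)
    (q : Params) (T : ℕ) (ω : ℕ × ℕ → Bool) (k : ℕ) :
    (run q T I (C.oracle p) W τ ω k).Within fun _ => level C.w (successes T ω k) := by
  induction k with
  | zero => exact hI.within ..
  | succ k ih =>
    have h := outerStep_within (q := q) (T := T) (k := k) (g := C.oracle p) (A := W (τ k))
      (ω := fun t => ω (k, t)) (Q := fun t _ => level C.w (successes T ω k +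
        ∑ t' ∈ Finset.range t, if ω (k, t') then 1 else 0)) ih
      (fun i => le_rfl) (fun _ _ _ => le_rfl)
      (fun t _ => level_mono _ (by rw [Finset.sum_range_succ]; lia)) ?_
    · rw [successes, Finset.sum_range_succ]
      exact h
    · intro t _ i u hu
      rw [Finset.sum_range_succ, ← add_assoc]
      by_cases hω : ω (k, t)
      · rw [if_pos hω]
        exact Submodule.smul_mem _ _ (C.grad_mem_level_w hu)
      · simp only [oracle, if_neg hω, zero_smul]
        exact Submodule.zero_mem _

theorem requiresAtLeast (hm : 0 < m) (hIe : I.Orthogonal C.e) (hIw : I.Orthogonal C.w)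
    (hτ : StrictMono τ) {p : ℝ} (hp0 : 0 < p) (hp1 : p ≤ 1) [IsProbabilityMeasure (coin p)]
    {gap : H → ℝ} (hgap : ∀ x, gap x = C.total x) {ε Ncomm Ncall : ℝ} (hε : 0 < ε)
    (hεe : ε < C.a * |C.b| / 3) (hcomm : Ncomm ≤ m * (C.D - 1)) (hεw : 2 * ε ≤ C.a' * |C.b'|)
    (hcall : Ncall ≤ C.D' / (2 * p)) :
    RequiresAtLeast gap (coin p) I (C.oracle p) (network hm τ) τ ε Ncomm Ncall := by
  intro K T q _ _ _ hgapε
  have hint := integrable_comp_output (Measure.infinitePi fun _ : ℕ × ℕ => coin p) gap q K T I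
    (C.oracle p) (network hm τ) τ
  constructor
  · refine hcomm.trans ?_
    by_contra! hK
    -- For `D = 0` the claimed bound is not positive.
    have hD : 1 ≤ C.D := by
      by_contra! h
      have h0 : (C.D : ℝ) = 0 := by exact_mod_cast Nat.lt_one_iff.1 h
      have h1 : (0 : ℝ) ≤ numCommunications K T := Nat.cast_nonneg _
      have h2 : (0 : ℝ) ≤ m := Nat.cast_nonneg _
      rw [h0] at hK
      linarith
    have hK' : K < m * (C.D - 1) := by
      rw [← Nat.cast_one, ← Nat.cast_sub hD, ← Nat.cast_mul] at hK
      exact Nat.cast_lt.1 hK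
    -- After `K` communications some nodes may know `K / m + 1` directions, so `e (K / m + 1)` is
    -- the first one surely missing; it must still belong to the chain.
    have hj : K / m + 1 < C.D := by
      have := Nat.div_lt_of_lt_mul hK'
      lia
    have hlow : ∀ ω, C.a * |C.b| / 3 ≤ gap (output q K T I (C.oracle p) (network hm τ) τ ω) := by
      intro ω
      rw [hgap]
      refine C.le_total_of_inner_e_eq_zero hj (output_mem (V := level C.e (K / m + 1))
        (fun k hk => ?_) (K / m + 1) le_rfl)
      exact (C.run_within_e hm hIe hτ p q T ω k).mono fun i => level_mono _
        ((reach_le m k i).trans (Nat.succ_le_succ (Nat.div_le_div_right hk)))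
    have h := integral_mono (integrable_const _) hint hlow
    simp only [integral_const, probReal_univ, one_smul] at h
    exact absurd (h.trans hgapε) hεe.not_ge
  · refine hcall.trans ?_
    have hD' : (0 : ℝ) < C.D' := Nat.cast_pos.2 C.D'_pos
    obtain ⟨B, hB⟩ : ∃ B, B = C.a' * |C.b'| := ⟨_, rfl⟩
    rw [← hB] at hεw
    have hB0 : 0 < B := by linarith
    -- Markov's inequality in pointwise form: with fewer than `D'` successes the gap is at least
    -- `B`, otherwise the left side is at most `0`.
    have hlow : ∀ ω, B - B / C.D' * successes T ω K ≤
        gap (output q K T I (C.oracle p) (network hm τ) τ ω) := by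
      intro ω
      rw [hgap]
      by_cases hN : successes T ω K < C.D'
      · have h1 : B ≤ C.total (output q K T I (C.oracle p) (network hm τ) τ ω) :=
          hB.le.trans (C.le_total_of_inner_w_eq_zero hN
            (output_mem (V := level C.w (successes T ω K)) (fun k hk =>
              (C.run_within_w hIw p (network hm τ) q T ω k).mono fun i => level_mono _
                (successes_mono T ω hk)) _ le_rfl))
        have h2 : 0 ≤ B / C.D' * successes T ω K := by positivity
        linarith
      · have h1 : (C.D' : ℝ) ≤ successes T ω K := Nat.cast_le.2 (not_lt.1 hN)
        have h2 : B / C.D' * C.D' ≤ B / C.D' * successes T ω K := by gcongr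
        rw [div_mul_cancel₀ _ hD'.ne'] at h2
        have := C.total_nonneg (output q K T I (C.oracle p) (network hm τ) τ ω)
        linarith
    obtain ⟨hi, hv⟩ := integral_successes hp0.le hp1 K T
    have h := integral_mono ((integrable_const B).sub (hi.const_mul (B / C.D'))) hint hlow
    simp only [Pi.sub_apply] at h
    rw [integral_sub (integrable_const B) (hi.const_mul _), integral_const_mul, hv,
      integral_const, probReal_univ, one_smul] at h
    have h1 : B * (1 - K * T * p / C.D') ≤ B * (1 / 2) := by
      have h2 : B * (1 - K * T * p / C.D') = B - B / C.D' * (K * T * p) := by ring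
      have h3 : ∫ ω, gap (output q K T I (C.oracle p) (network hm τ) τ ω)
        ∂Measure.infinitePi (fun _ : ℕ × ℕ => coin p) ≤ ε := hgapε
      linarith
    have h2 := le_of_mul_le_mul_left h1 hB0
    have h3 : (1 : ℝ) / 2 ≤ K * T * p / C.D' := by linarith
    rw [le_div_iff₀ hD'] at h3
    rw [numOracleCalls, Nat.cast_mul, div_le_iff₀ (by positivity)]
    linarith

end Chain

/-! ### The hard instances -/

/-- There are orthonormal vectors that are orthogonal to given vectors if the dimension is large
enough. -/
theorem exists_orthonormal_of_card_add_le {H ι : Type*} [NormedAddCommGroup H]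
    [InnerProductSpace ℝ H] [FiniteDimensional ℝ H] [Fintype ι] (u : ι → H) (N : ℕ)
    (h : Fintype.card ι + N ≤ Module.finrank ℝ H) :
    ∃ v : ℕ → H, (Pairwise fun i j => inner ℝ (v i) (v j) = 0) ∧ (∀ j, ‖v j‖ ≤ 1) ∧
      (∀ j < N, ‖v j‖ = 1) ∧ ∀ j i, inner ℝ (v j) (u i) = 0 := by
  set K := Submodule.span ℝ (Set.range u)
  have hK : Module.finrank ℝ K ≤ Fintype.card ι := finrank_range_le_card u
  have hKN : N ≤ Module.finrank ℝ Kᗮ := by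
    have := K.finrank_add_finrank_orthogonal
    lia
  let b := stdOrthonormalBasis ℝ Kᗮ
  -- Padding by `0` preserves orthogonality and `‖v j‖ ≤ 1`, but not unit norm. This is why a
  -- `Chain` has unit vectors only up to its lengths.
  refine ⟨fun j => if hj : j < Module.finrank ℝ Kᗮ then (b ⟨j, hj⟩ : H) else 0,
    fun i j hij => ?_, fun j => ?_, fun j hj => ?_, fun j i => ?_⟩
  · dsimp only
    split_ifs with hi hj
    · rw [← Submodule.coe_inner]
      exact b.orthonormal.2 (by simpa using hij)
    all_goals simp
  · dsimp only
    split_ifs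
    · exact (b.orthonormal.1 _).le
    · simp
  · dsimp only
    rw [dif_pos (hj.trans_le hKN)]
    exact b.orthonormal.1 _
  · dsimp only
    split_ifs with hj
    · rw [real_inner_comm]
      exact (b ⟨j, hj⟩).2 _ (Submodule.subset_span ⟨i, rfl⟩)
    · simp

/-- The length of the first chain. -/
def lenE (M R ε : ℝ) : ℕ := ⌊M * R / (25 * ε)⌋₊

/-- The length of the second chain. -/
def lenW (M R ε : ℝ) : ℕ := ⌊(M * R / (8 * ε)) ^ 2⌋₊

/-- The number of nodes of each class. -/
def classSize (χ : ℝ) : ℕ := if χ < 6 then 1 else ⌊χ / 3⌋₊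

theorem classSize_pos (χ : ℝ) : 0 < classSize χ := by
  unfold classSize
  split_ifs with h
  · exact one_pos
  · exact Nat.floor_pos.2 (by linarith)

theorem three_mul_classSize_le {χ : ℝ} (h : classSize χ ≠ 1) :
    ((3 * classSize χ : ℕ) : ℝ) ≤ χ := by
  unfold classSize at h ⊢
  split_ifs at h ⊢ with h6
  · exact absurd rfl h
  · have := Nat.floor_le (show 0 ≤ χ / 3 by linarith)
    push_cast
    linarith

theorem div_six_le_classSize (χ : ℝ) : χ / 6 ≤ classSize χ := by
  unfold classSize
  split_ifs with h6
  · push_cast; linarith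
  · have := Nat.lt_floor_add_one (χ / 3)
    linarith

/-- The hard instance for given orthonormal vectors. -/
theorem exists_chain {H : Type*} [NormedAddCommGroup H] [InnerProductSpace ℝ H] {M R χ σ ε : ℝ}
    (hM : 0 < M) (hR : 0 < R) (hχ : 1 ≤ χ) (hε : 0 < ε) (hεc : ε ≤ 1 / 1000 * M * R)
    {v : ℕ → H} (hv : Pairwise fun i j => inner ℝ (v i) (v j) = 0) (hv1 : ∀ j, ‖v j‖ ≤ 1)
    (hvN : ∀ j < 2 * (lenE M R ε + lenW M R ε), ‖v j‖ = 1) :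
    ∃ C : Chain H, (∀ j, C.e j ∈ Set.range v) ∧ (∀ j, C.w j ∈ Set.range v) ∧
      (∀ c x, ‖C.grad c x‖ ≤ M) ∧ ‖C.sol‖ ≤ R ∧ ε < C.a * |C.b| / 3 ∧
      1 / 1000 * (χ * M * R / ε) ≤ classSize χ * (C.D - 1) ∧ 2 * ε ≤ C.a' * |C.b'| ∧
      1 / 1000 * ((M + σ) ^ 2 * R ^ 2 / ε ^ 2) ≤ C.D' / (2 * (M ^ 2 / (M ^ 2 + σ ^ 2))) := by
  set ρ := M * R / ε with hρ
  have hρ0 : 1000 ≤ ρ := by rw [hρ, le_div_iff₀ hε]; linarith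
  have hMR : M * R = ρ * ε := by rw [hρ]; field_simp
  have hE : lenE M R ε = ⌊ρ / 25⌋₊ := by rw [lenE, hρ]; congr 1; field_simp
  have hW : lenW M R ε = ⌊(ρ / 8) ^ 2⌋₊ := by rw [lenW, hρ]; congr 2; field_simp
  have hDle : (lenE M R ε : ℝ) ≤ ρ / 25 := by rw [hE]; exact Nat.floor_le (by positivity)
  have hDge : ρ / 25 < lenE M R ε + 1 := by rw [hE]; exact Nat.lt_floor_add_one _
  have hD'le : (lenW M R ε : ℝ) ≤ (ρ / 8) ^ 2 := by rw [hW]; exact Nat.floor_le (by positivity)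
  have hD'ge : (ρ / 8) ^ 2 < lenW M R ε + 1 := by rw [hW]; exact Nat.lt_floor_add_one _
  set D := lenE M R ε
  set D' := lenW M R ε
  have hD0 : (0 : ℝ) < D := by linarith
  have hD'0 : (0 : ℝ) < D' := by nlinarith
  have hsD : √(D : ℝ) * √D = D := Real.mul_self_sqrt hD0.le
  have hsD0 : 0 < √(D : ℝ) := Real.sqrt_pos.2 hD0
  have hsD'0 : 0 < √(D' : ℝ) := Real.sqrt_pos.2 hD'0
  have hsD'le : √(D' : ℝ) ≤ ρ / 8 := Real.sqrt_le_iff.2 ⟨by positivity, hD'le⟩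
  let C : Chain H :=
    { e := fun j => v (2 * j)
      w := fun j => v (2 * j + 1)
      e_orth := fun i j hij => hv (by lia)
      w_orth := fun i j hij => hv (by lia)
      cross := fun i j => hv (by lia)
      e_norm := fun j => hv1 _
      w_norm := fun j => hv1 _
      D := D
      D' := D'
      D'_pos := Nat.cast_pos.1 hD'0
      e_unit := fun j hj => hvN _ (by lia)
      w_unit := fun j hj => hvN _ (by lia)
      -- Each chain gets half of the budget: `2 * a * √D = a' = M / 2` for the subgradients, and `b
      -- * √D = b' * √D' = R / 2` for the solution.
      a := M / (4 * √D)
      b := R / (2 * √D)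
      a' := M / 2
      b' := R / (2 * √D')
      a_nonneg := by positivity
      a'_nonneg := by positivity }
  have hb : |C.b| = R / (2 * √D) := abs_of_pos (by positivity)
  have hb' : |C.b'| = R / (2 * √D') := abs_of_pos (by positivity)
  refine ⟨C, fun j => ⟨_, rfl⟩, fun j => ⟨_, rfl⟩, fun c x => ?_, ?_, ?_, ?_, ?_, ?_⟩
  · refine (C.norm_grad_le c x).trans_eq ?_
    change 2 * (M / (4 * √D)) * √D + M / 2 = M
    field_simp
    norm_num
  · refine C.norm_sol_le.trans_eq ?_
    rw [hb, hb']
    change R / (2 * √D) * √D + R / (2 * √D') * √D' = R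
    field_simp
    norm_num
  · have h : C.a * |C.b| / 3 = ρ * ε / (24 * D) := by
      rw [hb, ← hMR]
      calc M / (4 * √D) * (R / (2 * √D)) / 3 = M * R / (24 * (√D * √D)) := by ring
        _ = _ := by rw [hsD]
    rw [h, lt_div_iff₀ (by positivity)]
    nlinarith
  · change _ ≤ (classSize χ : ℝ) * ((D : ℝ) - 1)
    have h1 : χ * M * R / ε = χ * ρ := by rw [hρ]; ring
    have h2 := div_six_le_classSize χ
    have h3 : ρ / 50 ≤ (D : ℝ) - 1 := by linarith
    have h4 : χ / 6 * (ρ / 50) ≤ classSize χ * ((D : ℝ) - 1) := by gcongr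
    rw [h1]
    nlinarith
  · rw [hb']
    change 2 * ε ≤ M / 2 * (R / (2 * √D'))
    -- The `8` in `lenW` is chosen so that `√D' ≤ ρ / 8` yields `2 * ε`, the factor `2` needed in
    -- the Markov argument.
    have h : M / 2 * (R / (2 * √(D' : ℝ))) = ρ * ε / (4 * √D') := by
      rw [← hMR]; field_simp; norm_num
    rw [h, le_div_iff₀ (by positivity)]
    nlinarith
  · change _ ≤ (D' : ℝ) / (2 * (M ^ 2 / (M ^ 2 + σ ^ 2)))
    have h1 : (M + σ) ^ 2 * R ^ 2 / ε ^ 2 = (M + σ) ^ 2 / M ^ 2 * ρ ^ 2 := by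
      rw [hρ]; field_simp
    have h2 : (D' : ℝ) / (2 * (M ^ 2 / (M ^ 2 + σ ^ 2))) = (M ^ 2 + σ ^ 2) / M ^ 2 * (D' / 2) := by
      field_simp
    have h3 : (M + σ) ^ 2 ≤ 2 * (M ^ 2 + σ ^ 2) := by nlinarith [sq_nonneg (M - σ)]
    have h4 : (M + σ) ^ 2 / M ^ 2 ≤ 2 * ((M ^ 2 + σ ^ 2) / M ^ 2) := by
      rw [← mul_div_assoc]; gcongr
    have h5 : ρ ^ 2 / 500 ≤ (D' : ℝ) / 2 := by nlinarith
    rw [h1, h2]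
    calc 1 / 1000 * ((M + σ) ^ 2 / M ^ 2 * ρ ^ 2)
        ≤ 1 / 1000 * (2 * ((M ^ 2 + σ ^ 2) / M ^ 2) * ρ ^ 2) := by gcongr
      _ = (M ^ 2 + σ ^ 2) / M ^ 2 * (ρ ^ 2 / 500) := by ring
      _ ≤ _ := by gcongr

/-- The vectors of the input. -/
def Input.vectors {n : ℕ} {H : Type*} [AddCommGroup H] (I : Input n H) : Fin n × Fin 4 → H
  | (i, 0) => I.x i
  | (i, 1) => I.y i
  | (i, 2) => I.z i
  | (i, 3) => I.m i

theorem Chain.cvxAssumptions {d m : ℕ} (hm : 0 < m) (C : Chain (Vec d)) {M R : ℝ}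
    (hgrad : ∀ c x, ‖C.grad c x‖ ≤ M) (hsol : ‖C.sol‖ ≤ R) :
    CvxAssumptions 0 M R (fun (i : Fin (3 * m)) x => C.fn (i % 3) x) C.sol := by
  have hobj : ∀ x, cvxObjective 0 (fun (i : Fin (3 * m)) x => C.fn (i % 3) x) x = C.total x := by
    intro x
    rw [cvxObjective, C.average_fn_eq_total hm]
    ring
  refine ⟨fun i => convexOn_of_forall_mem_subdiff (C.grad_mem_subdiff (i % 3)),
    fun i x g hg => norm_le_of_mem_subdiff (C.grad_mem_subdiff (i % 3)) (hgrad _) hg,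
    fun x => ?_, hsol⟩
  rw [hobj, hobj, C.total_sol]
  exact C.total_nonneg x

theorem cvxGap_sol {d m : ℕ} (hm : 0 < m) (C : Chain (Vec d)) (x : Vec d) :
    cvxGap 0 (fun (i : Fin (3 * m)) x => C.fn (i % 3) x) C.sol x = C.total x := by
  rw [cvxGap, cvxObjective, cvxObjective, C.average_fn_eq_total hm, C.average_fn_eq_total hm,
    C.total_sol]
  ring

/-! ### Saddle point problems that do not depend on the second variable. -/

section SaddlePoint

variable {d₁ d₂ m : ℕ} {C : Chain (Vec₂ d₁ d₂)}

/-- All directions of the chains lie in the first component. -/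
structure Chain.FstOnly (C : Chain (Vec₂ d₁ d₂)) : Prop where
  e : ∀ j, (C.e j).snd = 0
  w : ∀ j, (C.w j).snd = 0

/-- The function `C.fn c` as a function of two arguments. -/
def Chain.fn₂ (C : Chain (Vec₂ d₁ d₂)) (c : ℕ) (ξ : Vec d₁) (ζ : Vec d₂) : ℝ :=
  C.fn c (WithLp.toLp 2 (ξ, ζ))

namespace Chain.FstOnly

theorem res_congr (hC : C.FstOnly) (j : ℕ) {x y : Vec₂ d₁ d₂} (h : x.fst = y.fst) :
    C.res j x = C.res j y := by
  have hb : (C.back j).snd = 0 := by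
    cases j with
    | zero => rfl
    | succ j => exact hC.e j
  simp [Chain.res, WithLp.prod_inner_apply, inner_sub_left, h, hC.e j, hb]

theorem dev_congr (hC : C.FstOnly) (j : ℕ) {x y : Vec₂ d₁ d₂} (h : x.fst = y.fst) :
    C.dev j x = C.dev j y := by
  simp [Chain.dev, WithLp.prod_inner_apply, h, hC.w j]

theorem fn_congr (hC : C.FstOnly) (c : ℕ) {x y : Vec₂ d₁ d₂} (h : x.fst = y.fst) :
    C.fn c x = C.fn c y := by
  simp only [Chain.fn, Chain.link, Chain.peak, hC.res_congr _ h, hC.dev_congr _ h]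

theorem fn₂_eq (hC : C.FstOnly) (c : ℕ) (ξ : Vec d₁) (ζ : Vec d₂) {x : Vec₂ d₁ d₂}
    (h : x.fst = ξ) : C.fn₂ c ξ ζ = C.fn c x :=
  hC.fn_congr c h.symm

/-- As `C.fn₂` is constant in `ζ`, both sides force the second component to be `0`. The subgradient
facts and bounds for `C.fn` on the product space thus carry over. -/
theorem mem_sppOperator_iff (hC : C.FstOnly) (i : Fin (3 * m)) (x g : Vec₂ d₁ d₂) :
    g ∈ sppOperator (fun (i : Fin (3 * m)) => C.fn₂ (i % 3)) i x ↔
      g ∈ subdiff (C.fn (i % 3)) x := by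
  constructor
  · rintro ⟨h1, h2⟩ y
    -- Testing a constant function in the direction `g.snd` itself gives `‖g.snd‖² ≤ 0`.
    have h3 := h2 (x.snd + g.snd)
    beta_reduce at h3
    rw [hC.fn₂_eq _ _ _ (x := x) rfl, hC.fn₂_eq _ _ _ (x := x) rfl, add_sub_cancel_left,
      real_inner_self_eq_norm_sq] at h3
    have h4 : g.snd = 0 := by
      rw [← norm_eq_zero]; nlinarith [norm_nonneg g.snd]
    have h5 := h1 y.fst
    beta_reduce at h5
    rw [hC.fn₂_eq _ _ _ (x := x) rfl, hC.fn₂_eq _ _ _ (x := y) rfl] at h5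
    rw [WithLp.prod_inner_apply]
    simpa [h4] using h5
  · intro h
    constructor
    · intro ξ
      have h1 := h (WithLp.toLp 2 (ξ, x.snd))
      beta_reduce
      rw [hC.fn₂_eq _ _ _ (x := x) rfl]
      rw [WithLp.prod_inner_apply] at h1
      simpa [Chain.fn₂] using h1
    · intro ζ
      have h1 := h (WithLp.toLp 2 (x.fst, ζ))
      rw [hC.fn_congr (x := WithLp.toLp 2 (x.fst, ζ)) (y := x) _ rfl, WithLp.prod_inner_apply] at h1
      beta_reduce
      rw [hC.fn₂_eq _ _ _ (x := x) rfl, hC.fn₂_eq _ _ _ (x := x) rfl]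
      have h2 : inner ℝ g.snd (ζ - x.snd) ≤ 0 := by simpa using h1
      linarith

theorem sppObjective_eq (hC : C.FstOnly) (hm : 0 < m) (ξ : Vec d₁) (ζ : Vec d₂) {x : Vec₂ d₁ d₂}
    (h : x.fst = ξ) :
    sppObjective 0 (fun (i : Fin (3 * m)) => C.fn₂ (i % 3)) ξ ζ = C.total x := by
  rw [sppObjective, ← C.average_fn_eq_total hm]
  simp only [hC.fn₂_eq _ ξ ζ h]
  ring

theorem sppGap_sol (hC : C.FstOnly) (hm : 0 < m) (x : Vec₂ d₁ d₂) :
    sppGap 0 (fun (i : Fin (3 * m)) => C.fn₂ (i % 3)) C.sol x = C.total x := by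
  rw [sppGap, hC.sppObjective_eq hm _ _ (x := x) rfl, hC.sppObjective_eq hm _ _ (x := C.sol) rfl,
    C.total_sol, sub_zero]

theorem sppAssumptions (hC : C.FstOnly) (hm : 0 < m) {M R : ℝ} (hgrad : ∀ c x, ‖C.grad c x‖ ≤ M)
    (hsol : ‖C.sol‖ ≤ R) :
    SppAssumptions 0 M R (fun (i : Fin (3 * m)) => C.fn₂ (i % 3)) C.sol := by
  have hmem : ∀ (i : Fin (3 * m)) x,
      C.grad (i % 3) x ∈ sppOperator (fun (i : Fin (3 * m)) => C.fn₂ (i % 3)) i x := fun i x =>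
    (hC.mem_sppOperator_iff i x _).2 (C.grad_mem_subdiff _ x)
  refine ⟨fun i ζ => ?_, fun i ξ => ?_, fun i x g hg => ?_, fun ξ ζ => ?_, hsol⟩
  · exact convexOn_of_forall_mem_subdiff fun ξ => (hmem i (WithLp.toLp 2 (ξ, ζ))).1
  · exact neg_convexOn_iff.1
      (convexOn_of_forall_mem_subdiff fun ζ => (hmem i (WithLp.toLp 2 (ξ, ζ))).2)
  · exact norm_le_of_mem_subdiff (C.grad_mem_subdiff (i % 3)) (hgrad _)
      ((hC.mem_sppOperator_iff i x g).1 hg)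
  · rw [hC.sppObjective_eq hm _ ζ (x := C.sol) rfl, hC.sppObjective_eq hm _ _ (x := C.sol) rfl,
      hC.sppObjective_eq hm ξ _ (x := WithLp.toLp 2 (ξ, ζ)) rfl, C.total_sol]
    exact ⟨le_rfl, C.total_nonneg _⟩

end Chain.FstOnly

end SaddlePoint

end DecOpt

end

/-! ### Choice of the dimensions and of the problem against a given input and schedule. -/

theorem mainTheorem5 :
    ∃ c : ℝ, 0 < c ∧ ∀ M R χ σ ε : ℝ, 0 < M → 0 < R → 1 ≤ χ → 0 ≤ σ → 0 < ε → ε ≤ c * M * R →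
      -- convex minimization, `r = 0`
      (∃ n d : ℕ, 0 < n ∧ 0 < d ∧
        ∀ (I : DecOpt.Input n (DecOpt.Vec d)) (τ : ℕ → NNReal), StrictMono τ →
          ∃ (f : Fin n → DecOpt.Vec d → ℝ) (xs : DecOpt.Vec d)
            (edges : NNReal → Set (Fin n × Fin n)) (W : NNReal → Matrix (Fin n) (Fin n) ℝ)
            (S : Type) (_ : MeasurableSpace S) (law : MeasureTheory.Measure S)
            (_ : MeasureTheory.IsProbabilityMeasure law)
            (g : Fin n → S → DecOpt.Vec d → DecOpt.Vec d),
            DecOpt.CvxAssumptions 0 M R f xs ∧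
            DecOpt.NetworkAssumptions χ edges W ∧
            DecOpt.OracleAssumptions (DecOpt.cvxOperator f) σ law g ∧
            DecOpt.RequiresAtLeast (DecOpt.cvxGap 0 f xs) law I g W τ ε
              (c * (χ * M * R / ε)) (c * ((M + σ) ^ 2 * R ^ 2 / ε ^ 2))) ∧
      -- convex-concave saddle point problem, `r = 0`
      (∃ n d₁ d₂ : ℕ, 0 < n ∧ 0 < d₁ ∧ 0 < d₂ ∧
        ∀ (I : DecOpt.Input n (DecOpt.Vec₂ d₁ d₂)) (τ : ℕ → NNReal), StrictMono τ →
          ∃ (f : Fin n → DecOpt.Vec d₁ → DecOpt.Vec d₂ → ℝ) (xs : DecOpt.Vec₂ d₁ d₂)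
            (edges : NNReal → Set (Fin n × Fin n)) (W : NNReal → Matrix (Fin n) (Fin n) ℝ)
            (S : Type) (_ : MeasurableSpace S) (law : MeasureTheory.Measure S)
            (_ : MeasureTheory.IsProbabilityMeasure law)
            (g : Fin n → S → DecOpt.Vec₂ d₁ d₂ → DecOpt.Vec₂ d₁ d₂),
            DecOpt.SppAssumptions 0 M R f xs ∧
            DecOpt.NetworkAssumptions χ edges W ∧
            DecOpt.OracleAssumptions (DecOpt.sppOperator f) σ law g ∧
            DecOpt.RequiresAtLeast (DecOpt.sppGap 0 f xs) law I g W τ ε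
              (c * (χ * M * R / ε)) (c * ((M + σ) ^ 2 * R ^ 2 / ε ^ 2))) := by
  open DecOpt in
  refine ⟨1 / 1000, by norm_num, fun M R χ σ ε hM hR hχ hσ hε hεc => ?_⟩
  have hm := classSize_pos χ
  set m := classSize χ with hm_def
  set N := 2 * (lenE M R ε + lenW M R ε) with hN
  have hp0 : 0 < M ^ 2 / (M ^ 2 + σ ^ 2) := by positivity
  have hp1 : M ^ 2 / (M ^ 2 + σ ^ 2) ≤ 1 := (div_le_one (by positivity)).2 (by nlinarith)
  have := isProbabilityMeasure_coin hp0.le hp1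
  have hcard : Fintype.card (Fin (3 * m) × Fin 4) = 3 * m * 4 := by simp
  constructor
  -- The dimension is fixed before the input is known: four input vectors per node have to be
  -- avoided, and `N` directions must remain.
  · refine ⟨3 * m, 3 * m * 4 + N, by lia, by lia, fun I τ hτ => ?_⟩
    obtain ⟨v, hv, hv1, hvN, hvI⟩ := exists_orthonormal_of_card_add_le I.vectors N
      (by rw [hcard, finrank_euclideanSpace_fin])
    obtain ⟨C, hCe, hCw, hgrad, hsol, h1, h2, h3, h4⟩ :=
      exists_chain (σ := σ) hM hR hχ hε hεc hv hv1 hvN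
    have horth : ∀ u : ℕ → Vec (3 * m * 4 + N), (∀ j, u j ∈ Set.range v) → I.Orthogonal u := by
      intro u hu i l
      obtain ⟨j, hj⟩ := hu l
      rw [← hj]
      exact ⟨hvI j (i, 0), hvI j (i, 1), hvI j (i, 2), hvI j (i, 3)⟩
    exact ⟨_, C.sol, _, network hm τ, Bool, inferInstance, _, this, _,
      C.cvxAssumptions hm hgrad hsol,
      networkAssumptions_network hm hχ three_mul_classSize_le τ,
      C.oracleAssumptions hM (fun i x => C.grad_mem_subdiff _ x) hgrad,
      C.requiresAtLeast hm (horth _ hCe) (horth _ hCw) hτ hp0 hp1 (cvxGap_sol hm C) hε h1 h2 h3 h4⟩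
  · refine ⟨3 * m, 3 * m * 4 + N, 1, by lia, by lia, one_pos, fun I τ hτ => ?_⟩
    -- The directions live in the first component, so only the first components of the input have to
    -- be avoided.
    obtain ⟨v, hv, hv1, hvN, hvI⟩ := exists_orthonormal_of_card_add_le
      (fun p => (I.vectors p).fst) N (by rw [hcard, finrank_euclideanSpace_fin])
    let v' : ℕ → Vec₂ (3 * m * 4 + N) 1 := fun j => WithLp.toLp 2 (v j, 0)
    have hnorm : ∀ j, ‖v' j‖ = ‖v j‖ := fun j => WithLp.norm_toLp_fst 2 _ _ (v j)
    have hinner : ∀ j x, inner ℝ (v' j) x = inner ℝ (v j) x.fst := fun j x => by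
      simp [v', WithLp.prod_inner_apply]
    obtain ⟨C, hCe, hCw, hgrad, hsol, h1, h2, h3, h4⟩ :=
      exists_chain (σ := σ) (v := v') hM hR hχ hε hεc
        (fun i j hij => (hinner i _).trans (hv hij)) (fun j => (hnorm j).trans_le (hv1 j))
        (fun j hj => (hnorm j).trans (hvN j hj))
    have hsnd : ∀ u ∈ Set.range v', u.snd = 0 := by
      rintro _ ⟨j, rfl⟩
      rfl
    have hC : C.FstOnly := ⟨fun j => hsnd _ (hCe j), fun j => hsnd _ (hCw j)⟩
    have horth : ∀ u : ℕ → Vec₂ (3 * m * 4 + N) 1, (∀ j, u j ∈ Set.range v') →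
        I.Orthogonal u := by
      intro u hu i l
      obtain ⟨j, hj⟩ := hu l
      simp only [← hj, hinner]
      exact ⟨hvI j (i, 0), hvI j (i, 1), hvI j (i, 2), hvI j (i, 3)⟩
    exact ⟨_, C.sol, _, network hm τ, Bool, inferInstance, _, this, _,
      hC.sppAssumptions hm hgrad hsol,
      networkAssumptions_network hm hχ three_mul_classSize_le τ,
      C.oracleAssumptions hM (fun i x => (hC.mem_sppOperator_iff i x _).2
        (C.grad_mem_subdiff _ x)) hgrad,
      C.requiresAtLeast hm (horth _ hCe) (horth _ hCw) hτ hp0 hp1 (hC.sppGap_sol hm) hε h1 h2 h3 h4⟩
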